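/- Let $\Omega_2\subset\mathbf{R}^2$ be a nonempty bounded open convex set, let $\delta>0$, let $\Lambda\subset\mathbf{R}^2\times[-\frac1\delta,-\delta]$ be compact (for example $\Lambda=\overline{B}_D(0)\times[-\frac1\delta,-\delta]$), and let $\nu$ be a Borel probability measure on $\mathbf{R}^3$ with $\operatorname{supp}\nu\subset\Lambda$. Let $$H>\frac{2}{\mathcal{L}^2(\Omega_2)}+\frac{2\sup_{\Omega_2}|x|+\max_{y\in\Lambda}(|y_1|+|y_2|)}{\delta}\,\operatorname{diam}\Omega_2. \tag{2.17}$$ For $h:\Omega_2\to[0,\infty)$ put $\Omega_h=\{x\in\mathbf{R}^3:(x_1,x_2)\in\Omega_2,\ 0<x_3<h(x_1,x_2)\}$ and let $\sigma_h$ be Lebesgue measure restricted to $\Omega_h$; put $\Omega_H=\Omega_2\times[0,H]$. Let $\mathcal{M}_\nu$ be the set of pairs $(h,\gamma)$ where $h:\Omega_2\to[0,\infty)$ is continuous with $\int_{\Omega_2}h=1$ and $\gamma$ is a Borel measure on $\mathbf{R}^3\times\mathbf{R}^3$ with marginals $\sigma_h$ and $\nu$, and define $$E_\nu(h,\gamma)=\int\Big(\tfrac12\big[(x_1-y_1)^2+(x_2-y_2)^2\big]-x_3y_3\Big)\,d\gamma(x,y)\in[0,\infty],\qquad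 (h,\gamma)\in\mathcal{M}_\nu .$$ Let $\mathcal{N}$ be the set of pairs of functions $P:\Omega_H\to\mathbf{R}$, $R:\Lambda\to\mathbf{R}$ with $P\in L^1(\Omega_H)$, $R\in L^1(\nu)$ and $P(x)+R(y)\ge x\cdot y$ for all $x\in\Omega_H$, $y\in\Lambda$, and for $(P,R)\in\mathcal{N}$ define $$J_\nu^H(P,R)=\int_\Lambda\Big(\tfrac12(y_1^2+y_2^2)-R(y)\Big)d\nu(y)+\inf_{0\le h\le H}\int_{\Omega_h}\Big(\tfrac12(x_1^2+x_2^2)-P(x)\Big)dx,$$ the infimum being over measurable $h:\Omega_2\to[0,H]$. Call $(P,R)$ convex conjugate over $\Omega_H$ and $\Lambda$ if $P(x)=\sup_{y\in\Lambda}(x\cdot y-R(y))$ for all $x\in\Omega_H$ and $R(y)=\sup_{x\in\Omega_H}(x\cdot y-P(x))$ for all $y\in\Lambda$. For such $P$ and $(x_1,x_2)\in\Omega_2$, let $h_P^H(x_1,x_2)$ be the unique point of $[0,H]$ at which $s\mapsto\int_0^s\big(\tfrac12(x_1^2+x_2^2)-P(x_1,x_2,x_3)\big)dx_3$ attains its minimum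 over $[0,H]$. Then: (i) $E_\nu$ has a unique minimizer $(h,\gamma)$ over $\mathcal{M}_\nu$. (ii) If $(P_0,R_0)$ and $(P_1,R_1)$ both maximize $J_\nu^H$ over $\mathcal{N}$ and both are convex conjugate over $\Omega_H$ and $\Lambda$, then $h_{P_0}^H=h_{P_1}^H=:h$ on $\Omega_2$, and $P_0=P_1$ on $\Omega_h$. -/

import Mathlib

open MeasureTheory Set

noncomputable section

namespace SemiGeostrophic

/-- The horizontal plane `ℝ²` with its Euclidean norm. -/
abbrev Plane : Type := EuclideanSpace ℝ (Fin 2)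

/-- Three-dimensional space `ℝ³ = ℝ² × ℝ`: `x.1 = (x₁, x₂)` and `x.2 = x₃`. Its `volume` is the
Lebesgue measure; its product norm is never used. -/
abbrev Space : Type := Plane × ℝ

/-- The Euclidean scalar product `x · y = x₁ y₁ + x₂ y₂ + x₃ y₃`. -/
def dot (x y : Space) : ℝ := inner ℝ x.1 y.1 + x.2 * y.2

/-- The cost `c(x, y) = ½ ((x₁ - y₁)² + (x₂ - y₂)²) - x₃ y₃`. -/
def cost (x y : Space) : ℝ := ‖x.1 - y.1‖ ^ 2 / 2 - x.2 * y.2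

/-- The cost is nonnegative where `x₃ ≥ 0` and `y₃ ≤ 0`. -/
theorem cost_nonneg {x y : Space} (hx : 0 ≤ x.2) (hy : y.2 ≤ 0) : 0 ≤ cost x y := by
  have h1 : x.2 * y.2 ≤ 0 := mul_nonpos_of_nonneg_of_nonpos hx hy
  have h2 : 0 ≤ ‖x.1 - y.1‖ ^ 2 / 2 := by positivity
  unfold cost
  linarith

/-- The cylinder `Ω_H = Ω₂ × [0, H]`. -/
def cylinder (Ω₂ : Set Plane) (H : ℝ) : Set Space := Ω₂ ×ˢ Icc 0 H

/-- The region `Ω_h = {x : (x₁, x₂) ∈ Ω₂, 0 < x₃ < h(x₁, x₂)}` below the graph of `h`. -/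
def subgraph (Ω₂ : Set Plane) (h : Plane → ℝ) : Set Space :=
  {x | x.1 ∈ Ω₂ ∧ 0 < x.2 ∧ x.2 < h x.1}

/-- The measure `σ_h` with Lebesgue density the indicator function of `Ω_h`. -/
def sigma (Ω₂ : Set Plane) (h : Plane → ℝ) : Measure Space :=
  volume.restrict (subgraph Ω₂ h)

/-- Membership of `(h, γ)` in the class `M_ν`: `h` is a nonnegative continuous function on `Ω₂` of
integral one, and `γ` is a transport plan with marginals `σ_h` and `ν`. Only the values of `h` on
`Ω₂` matter. -/
structure IsAdmissible (Ω₂ : Set Plane) (ν : Measure Space)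
    (h : Plane → ℝ) (γ : Measure (Space × Space)) : Prop where
  nonneg : ∀ z ∈ Ω₂, 0 ≤ h z
  continuousOn : ContinuousOn h Ω₂
  integral_eq_one : ∫ z in Ω₂, h z = 1
  fst_marginal : γ.map Prod.fst = sigma Ω₂ h
  snd_marginal : γ.map Prod.snd = ν

/-- The energy `E_ν(h, γ) = ∫ c(x, y) dγ(x, y)`, with values in `[0, ∞]`. For an admissible
`(h, γ)` with `ν` concentrated on `{y₃ < 0}` one has `c ≥ 0` `γ`-almost everywhere
(see `cost_nonneg`), so that `ENNReal.ofReal` cuts nothing off; the value is `∞` exactly if `c` is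
not `γ`-integrable. -/
def energy (γ : Measure (Space × Space)) : ENNReal :=
  ∫⁻ q, ENNReal.ofReal (cost q.1 q.2) ∂γ

/-- `(h, γ)` minimizes `E_ν` over `M_ν`. -/
def IsMinimizer (Ω₂ : Set Plane) (ν : Measure Space)
    (h : Plane → ℝ) (γ : Measure (Space × Space)) : Prop :=
  IsAdmissible Ω₂ ν h γ ∧
    ∀ (h' : Plane → ℝ) (γ' : Measure (Space × Space)),
      IsAdmissible Ω₂ ν h' γ' → energy γ ≤ energy γ'

/-- The pairs `(P, R)` on which `J_ν^H` is considered: `P` is integrable on `Ω_H`, `R` is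
`ν`-integrable, and `P(x) + R(y) ≥ x · y` for all `x ∈ Ω_H` and `y ∈ Λ`. -/
structure IsDualAdmissible (Ω₂ : Set Plane) (Λ : Set Space) (ν : Measure Space) (H : ℝ)
    (P R : Space → ℝ) : Prop where
  integrable_left : IntegrableOn P (cylinder Ω₂ H)
  integrable_right : IntegrableOn R Λ ν
  dot_le : ∀ x ∈ cylinder Ω₂ H, ∀ y ∈ Λ, dot x y ≤ P x + R y

/-- The dual functional `J_ν^H(P, R)`, equal to
`∫_Λ (½ (y₁² + y₂²) - R) dν + inf_{0 ≤ h ≤ H} ∫_{Ω_h} (½ (x₁² + x₂²) - P) dx`, the infimum being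
over measurable `h`. On the pairs above and for bounded `Ω₂` both integrals converge and the set
of which the infimum is taken is nonempty and bounded below. -/
def dualFunctional (Ω₂ : Set Plane) (Λ : Set Space) (ν : Measure Space) (H : ℝ)
    (P R : Space → ℝ) : ℝ :=
  (∫ y in Λ, (‖y.1‖ ^ 2 / 2 - R y) ∂ν) +
    sInf {v : ℝ | ∃ h : Plane → ℝ, Measurable h ∧ (∀ z ∈ Ω₂, 0 ≤ h z ∧ h z ≤ H) ∧
      v = ∫ x, (‖x.1‖ ^ 2 / 2 - P x) ∂(sigma Ω₂ h)}

/-- `(P, R)` maximizes `J_ν^H`. -/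
def IsDualMaximizer (Ω₂ : Set Plane) (Λ : Set Space) (ν : Measure Space) (H : ℝ)
    (P R : Space → ℝ) : Prop :=
  IsDualAdmissible Ω₂ Λ ν H P R ∧
    ∀ P' R' : Space → ℝ, IsDualAdmissible Ω₂ Λ ν H P' R' →
      dualFunctional Ω₂ Λ ν H P' R' ≤ dualFunctional Ω₂ Λ ν H P R

/-- `f` and `g` are convex conjugate to each other over `A` and `B`:
`f(x) = sup_{y ∈ B} (x · y - g(y))` on `A` and `g(y) = sup_{x ∈ A} (x · y - f(x))` on `B`. -/
def IsConvexConjugate (A B : Set Space) (f g : Space → ℝ) : Prop :=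
  (∀ x ∈ A, IsLUB ((fun y => dot x y - g y) '' B) (f x)) ∧
    (∀ y ∈ B, IsLUB ((fun x => dot x y - f x) '' A) (g y))

/-- `Π_P(x₁, x₂, s) = ∫₀ˢ (½ (x₁² + x₂²) - P(x₁, x₂, t)) dt`. -/
def potential (P : Space → ℝ) (z : Plane) (s : ℝ) : ℝ :=
  ∫ t in (0 : ℝ)..s, (‖z‖ ^ 2 / 2 - P (z, t))

/-- `h = h_P^H` on `Ω₂`: for every `z ∈ Ω₂`, the function `s ↦ Π_P(z, s)` has a unique minimum
point over `[0, H]`, and this point is `h z`. -/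
def IsTruncatedProfile (Ω₂ : Set Plane) (H : ℝ) (P : Space → ℝ) (h : Plane → ℝ) : Prop :=
  ∀ z ∈ Ω₂, h z ∈ Icc 0 H ∧
    ∀ s ∈ Icc 0 H, s ≠ h z → potential P z (h z) < potential P z s

/-- The lower bound imposed on the truncation height:
`2 / |Ω₂| + (2 max_{Ω₂} |x| + max_Λ (|y₁| + |y₂|)) / δ · diam Ω₂`. -/
def heightBound (Ω₂ : Set Plane) (Λ : Set Space) (δ : ℝ) : ℝ :=
  2 / (volume Ω₂).toReal +
    (2 * sSup ((fun x : Plane => ‖x‖) '' Ω₂) +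
      sSup ((fun y : Space => |y.1 0| + |y.1 1|) '' Λ)) / δ * Metric.diam Ω₂

end SemiGeostrophic

end

/-!
# Uniqueness of the minimal energy configuration

Everything is read off from one maximizer of a dual problem on continuous functions. For
`R : C(Λ, ℝ)` let `P = conj R` be its Legendre transform. As `Λ` lies below height `-δ`, the
function `gap R = ½ (x₁² + x₂²) - P` increases vertically at rate at least `δ`, so that among all
regions below a graph its integral is smallest over the region `{gap R < 0}`, which lies below the
graph of the continuous function `profile H R`. Hence the infimum in `J_ν^H(P, R)` is the integral
of `min (gap R) 0` over the cylinder, and `J_ν^H(P, R)` becomes the function `dualValue` of `R`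
alone (`dualFunctional_eq_dualValue`).

* Existence. Replacing `R` by its double transform over the bounded cylinder makes it Lipschitz
  with a fixed constant, and adding large constants to `R` is penalized in both directions; so a
  maximizer exists by Arzelà–Ascoli (`exists_dualValue_maximizer`).
* Euler–Lagrange equation. By Rademacher's theorem the supremum in `conj R` is attained almost
  everywhere at the gradient `T` of `conj R` only. Varying `R` in the direction `φ` gives
  `∫_{Ω_h} φ(T x) dx = ∫ φ dν`, that is, `T_# σ_h = ν` for the profile `h` of a maximizer
  (`map_gradConj_eq`). In particular `∫ h = 1`, and the lower bound on `H` together with the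
  Lipschitz bound for `h` gives `h < H` (`profile_lt`).
* Minimality and uniqueness. The cost splits as `c(x, y) = gap R x + (½ (y₁² + y₂²) - R y)` plus
  the slack in `x · y ≤ P(x) + R(y)`. The plan `(id × T)_# σ_h` has no slack. For any other
  admissible pair, the integral of the gap is larger unless the profile is `h`, and the slack
  vanishes only if the plan is carried by the graph of `T` (`isMinimizer_plan`).
* Dual maximizers. A convex conjugate maximizer `(P, R)` is of the form `(conj R, R)` with `R` a
  maximizer of `dualValue`. So two of them lead to the same unique minimizer: they have the same
  profile and almost everywhere the same gradient on `Ω_h`. Then they have a common subgradient at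
  every point of `Ω_h`, differ by a constant on every column, and agree at its top, where both
  equal `½ (x₁² + x₂²)` because `h < H` (`conj_eqOn_subgraph`).
-/

namespace SemiGeostrophic

open Filter Topology

variable {Λ : Set Space}

/-! ### The scalar product and the Legendre transform of a continuous function on `Λ` -/

theorem dot_sub_left (x x' y : Space) : dot x y - dot x' y = dot (x - x') y := by
  simp only [dot, Prod.fst_sub, Prod.snd_sub, inner_sub_left]
  ring

theorem dot_sub_right (x y y' : Space) : dot x y - dot x y' = dot x (y - y') := by
  simp only [dot, Prod.fst_sub, Prod.snd_sub, inner_sub_right]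
  ring

theorem abs_dot_le (x y : Space) : |dot x y| ≤ ‖x.1‖ * ‖y.1‖ + |x.2| * |y.2| := by
  unfold dot
  refine (abs_add_le _ _).trans (add_le_add (abs_real_inner_le_norm _ _) ?_)
  rw [abs_mul]

theorem continuous_dot : Continuous fun q : Space × Space => dot q.1 q.2 := by
  unfold dot
  fun_prop

/-- Expanding the square, the cost splits into a function of `x`, a function of `y` and the
scalar product. -/
theorem cost_eq (x y : Space) : cost x y = ‖x.1‖ ^ 2 / 2 + ‖y.1‖ ^ 2 / 2 - dot x y := by
  unfold cost dot
  rw [norm_sub_sq_real]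
  ring

theorem continuous_cost : Continuous fun q : Space × Space => cost q.1 q.2 := by
  unfold cost
  fun_prop

/-- The Legendre transform `x ↦ sup_{y ∈ Λ} (x · y - R(y))` of a continuous function on `Λ`. It is
defined on all of `ℝ³`; its restriction to `Ω_H` is the potential `P` of the dual problem. -/
noncomputable def conj (R : C(Λ, ℝ)) (x : Space) : ℝ := ⨆ y : Λ, (dot x y - R y)

theorem continuous_dot_sub (R : C(Λ, ℝ)) (x : Space) :
    Continuous fun y : Λ => dot x y - R y := by
  have := continuous_dot.comp
    (continuous_const (y := x).prodMk (continuous_subtype_val (p := (· ∈ Λ))))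
  exact this.sub R.continuous

/-- The gradient of `conj R`, as a vector of `ℝ³`; it is the transport map of the problem.
At a point where `conj R` is not differentiable the value is meaningless. -/
noncomputable def gradConj (R : C(Λ, ℝ)) (x : Space) : Space :=
  (∑ i, fderiv ℝ (conj R) x (EuclideanSpace.single i 1, 0) • EuclideanSpace.single i (1 : ℝ),
    fderiv ℝ (conj R) x (0, 1))

theorem measurable_gradConj (R : C(Λ, ℝ)) : Measurable (gradConj R) := by
  unfold gradConj
  refine Measurable.prodMk (Finset.measurable_sum _ fun i _ => ?_)
    (measurable_fderiv_apply_const ℝ _ _)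
  exact (measurable_fderiv_apply_const ℝ _ _).smul_const _

section Conj

variable [CompactSpace Λ] [Nonempty Λ]

theorem isLUB_conj (R : C(Λ, ℝ)) (x : Space) :
    IsLUB (range fun y : Λ => dot x y - R y) (conj R x) :=
  isLUB_ciSup (isCompact_range (continuous_dot_sub R x)).bddAbove

theorem dot_sub_le_conj (R : C(Λ, ℝ)) (x : Space) (y : Λ) : dot x y - R y ≤ conj R x :=
  (isLUB_conj R x).1 ⟨y, rfl⟩

theorem exists_conj_eq (R : C(Λ, ℝ)) (x : Space) : ∃ y : Λ, conj R x = dot x y - R y := by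
  obtain ⟨y, hy⟩ := (isCompact_range (continuous_dot_sub R x)).sSup_mem (range_nonempty _)
  exact ⟨y, hy.symm⟩

/-- A point of `Λ` that attains the supremum at `x` is a subgradient at `x`. -/
theorem conj_sub_conj_le {R : C(Λ, ℝ)} {x : Space} {y : Λ} (hy : conj R x = dot x y - R y)
    (x' : Space) : conj R x - conj R x' ≤ dot (x - x') y := by
  rw [← dot_sub_left]
  linarith [dot_sub_le_conj R x' y]

theorem abs_conj_sub_conj_le (R : C(Λ, ℝ)) {x x' : Space} {c : ℝ}
    (hc : ∀ y ∈ Λ, |dot (x - x') y| ≤ c) : |conj R x - conj R x'| ≤ c := by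
  obtain ⟨y, hy⟩ := exists_conj_eq R x
  obtain ⟨y', hy'⟩ := exists_conj_eq R x'
  have h1 := conj_sub_conj_le hy x'
  have h2 := conj_sub_conj_le hy' x
  have h3 : dot (x' - x) y' = - dot (x - x') y' := by
    rw [← dot_sub_left, ← dot_sub_left]; ring
  rw [abs_le]
  constructor
  · linarith [(abs_le.1 (hc y' y'.2)).1]
  · linarith [(abs_le.1 (hc y y.2)).2]

theorem exists_lipschitzWith_conj (R : C(Λ, ℝ)) : ∃ K, LipschitzWith K (conj R) := by
  obtain ⟨B, hB⟩ := (isCompact_iff_compactSpace.2 ‹CompactSpace Λ›).isBounded.exists_norm_le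
  have hB0 : 0 ≤ B := (norm_nonneg _).trans (hB _ (Classical.arbitrary Λ).2)
  refine ⟨(2 * B).toNNReal, LipschitzWith.of_dist_le_mul fun x x' => ?_⟩
  rw [Real.dist_eq, Real.coe_toNNReal _ (by positivity), dist_eq_norm]
  refine abs_conj_sub_conj_le R fun y hy => (abs_dot_le _ _).trans ?_
  have h1 := hB y hy
  have h2 : ‖y.1‖ ≤ B := (norm_fst_le y).trans h1
  have h3 : |y.2| ≤ B := (norm_snd_le y).trans h1
  have h4 : ‖(x - x').1‖ ≤ ‖x - x'‖ := norm_fst_le (x - x')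
  have h5 : |(x - x').2| ≤ ‖x - x'‖ := norm_snd_le (x - x')
  calc _ ≤ ‖x - x'‖ * B + ‖x - x'‖ * B := by gcongr
    _ = _ := by ring

theorem continuous_conj (R : C(Λ, ℝ)) : Continuous (conj R) :=
  (exists_lipschitzWith_conj R).choose_spec.continuous

theorem conj_le_conj_add {R R' : C(Λ, ℝ)} {c : ℝ} (h : ∀ y, R' y ≤ R y + c) (x : Space) :
    conj R x ≤ conj R' x + c := by
  obtain ⟨y, hy⟩ := exists_conj_eq R x
  linarith [dot_sub_le_conj R' x y, h y]

theorem abs_conj_sub_conj_le_norm (R R' : C(Λ, ℝ)) (x : Space) :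
    |conj R x - conj R' x| ≤ ‖R - R'‖ := by
  have h : ∀ y, |R y - R' y| ≤ ‖R - R'‖ := fun y => (R - R').norm_coe_le_norm y
  rw [abs_le]
  constructor
  · linarith [conj_le_conj_add (R := R') (R' := R) (fun y => by linarith [(abs_le.1 (h y)).2]) x]
  · linarith [conj_le_conj_add (R := R) (R' := R') (fun y => by linarith [(abs_le.1 (h y)).1]) x]

/-- Along vertical lines `conj R` decreases at rate at least `δ`, as `Λ` lies below height `-δ`. -/
theorem conj_vertical {δ : ℝ} (hΛ : ∀ y ∈ Λ, y.2 ≤ -δ) (R : C(Λ, ℝ)) (z : Plane) {s t : ℝ}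
    (hst : s ≤ t) : conj R (z, t) ≤ conj R (z, s) - δ * (t - s) := by
  obtain ⟨y, hy⟩ := exists_conj_eq R (z, t)
  have h := conj_sub_conj_le hy (z, s)
  simp only [dot, Prod.mk_sub_mk, sub_self, inner_zero_left, zero_add] at h
  nlinarith [hΛ y y.2]

/-! ### The first variation of the Legendre transform -/

theorem eq_gradConj {R : C(Λ, ℝ)} {x : Space} (hd : DifferentiableAt ℝ (conj R) x) {y : Λ}
    (hy : conj R x = dot x y - R y) : (y : Space) = gradConj R x := by
  let ℓ : Space →L[ℝ] ℝ := (innerSL ℝ (y : Space).1).comp (ContinuousLinearMap.fst ℝ Plane ℝ) +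
    (y : Space).2 • ContinuousLinearMap.snd ℝ Plane ℝ
  have hℓ : ∀ v, ℓ v = dot v y := fun v => by
    simp [ℓ, dot, real_inner_comm, mul_comm]
  have hmin : IsLocalMin (fun x' => conj R x' - ℓ x') x := by
    refine Filter.Eventually.of_forall fun x' => ?_
    have := conj_sub_conj_le hy x'
    rw [← dot_sub_left] at this
    simp only [hℓ]
    linarith
  have h0 := hmin.hasFDerivAt_eq_zero (hd.hasFDerivAt.sub ℓ.hasFDerivAt)
  have h1 : fderiv ℝ (conj R) x = ℓ := sub_eq_zero.1 h0
  unfold gradConj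
  rw [h1]
  simp only [hℓ, dot]
  ext i
  · fin_cases i <;> simp [EuclideanSpace.inner_single_left]
  · simp

/-- By Rademacher's theorem the supremum in `conj R` is attained at `gradConj R` only, for almost
every point. -/
theorem ae_eq_gradConj (R : C(Λ, ℝ)) :
    ∀ᵐ x : Space, ∀ y : Λ, conj R x = dot x y - R y → (y : Space) = gradConj R x := by
  obtain ⟨K, hK⟩ := exists_lipschitzWith_conj R
  have : (volume : Measure Space).IsAddHaarMeasure := Measure.prod.instIsAddHaarMeasure _ _
  filter_upwards [hK.ae_differentiableAt (μ := volume)] with x hx y hy using eq_gradConj hx hy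

/-- If the supremum in `conj R x` is attained at `y` only, then the derivative at `ε = 0` of
`ε ↦ conj (R + ε φ) x` from the right is `-φ(y)`. -/
theorem tendsto_conj_quotient (R φ : C(Λ, ℝ)) {x : Space} {y : Λ} (hy : conj R x = dot x y - R y)
    (huniq : ∀ y' : Λ, conj R x = dot x y' - R y' → y' = y) :
    Tendsto (fun ε : ℝ => (conj R x - conj (R + ε • φ) x) / ε) (𝓝[>] 0) (𝓝 (φ y)) := by
  choose m hm using fun ε : ℝ => exists_conj_eq (R + ε • φ) x
  have hlow : ∀ ε : ℝ, ε * φ (m ε) ≤ conj R x - conj (R + ε • φ) x := fun ε => by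
    have h1 := dot_sub_le_conj R x (m ε)
    have h2 := hm ε
    simp only [ContinuousMap.add_apply, ContinuousMap.smul_apply, smul_eq_mul] at h2
    linarith
  have hup : ∀ ε : ℝ, conj R x - conj (R + ε • φ) x ≤ ε * φ y := fun ε => by
    have h1 := dot_sub_le_conj (R + ε • φ) x y
    simp only [ContinuousMap.add_apply, ContinuousMap.smul_apply, smul_eq_mul] at h1
    linarith
  -- The maximizers `m ε` of the perturbed problem converge to `y`: every cluster point attains
  -- the supremum in `conj R x`.
  have hmlim : Tendsto m (𝓝[>] 0) (𝓝 y) := by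
    refine isCompact_univ.tendsto_nhds_of_unique_mapClusterPt (by simp) fun y' _ hy' => ?_
    refine huniq y' ?_
    have hval : Tendsto (fun ε : ℝ => dot x (m ε) - R (m ε)) (𝓝[>] 0) (𝓝 (conj R x)) := by
      have hb : ∀ ε : ℝ, |(dot x (m ε) - R (m ε)) - conj R x| ≤ 2 * (|ε| * ‖φ‖) := fun ε => by
        have h1 := abs_conj_sub_conj_le_norm (R + ε • φ) R x
        rw [add_sub_cancel_left, norm_smul, Real.norm_eq_abs] at h1
        have h2 : |ε * φ (m ε)| ≤ |ε| * ‖φ‖ := by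
          rw [abs_mul]
          exact mul_le_mul_of_nonneg_left (φ.norm_coe_le_norm _) (abs_nonneg _)
        have h3 := hm ε
        simp only [ContinuousMap.add_apply, ContinuousMap.smul_apply, smul_eq_mul] at h3
        rw [abs_le] at h1 h2 ⊢
        constructor <;> linarith [h1.1, h1.2, h2.1, h2.2]
      rw [tendsto_iff_norm_sub_tendsto_zero]
      refine squeeze_zero (fun _ => norm_nonneg _) hb ?_
      have : Tendsto (fun ε : ℝ => 2 * (|ε| * ‖φ‖)) (𝓝 0) (𝓝 (2 * (|0| * ‖φ‖))) :=
        Continuous.tendsto (by fun_prop) 0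
      simp only [abs_zero, zero_mul, mul_zero] at this
      exact this.mono_left nhdsWithin_le_nhds
    have hcl : MapClusterPt (dot x y' - R y') (𝓝[>] (0 : ℝ))
        (fun ε : ℝ => dot x (m ε) - R (m ε)) :=
      hy'.continuousAt_comp (continuous_dot_sub R x).continuousAt
    have := hcl.clusterPt.mono hval
    exact (eq_of_nhds_neBot this).symm
  refine tendsto_of_tendsto_of_tendsto_of_le_of_le'
    ((φ.continuous.tendsto y).comp hmlim) tendsto_const_nhds ?_ ?_
  · filter_upwards [self_mem_nhdsWithin] with ε hε
    rw [le_div_iff₀ hε]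
    simpa [mul_comm] using hlow ε
  · filter_upwards [self_mem_nhdsWithin] with ε hε
    rw [div_le_iff₀ hε]
    simpa [mul_comm] using hup ε

end Conj

/-! ### The free surface determined by a potential -/

/-- The function `½ (x₁² + x₂²) - P(x)` for `P = conj R`. A column of fluid is cheapest if it is
filled exactly where this function is negative. -/
noncomputable def gap (R : C(Λ, ℝ)) (x : Space) : ℝ := ‖x.1‖ ^ 2 / 2 - conj R x

/-- The truncated profile `h_P^H` for `P = conj R`. The function `gap R` is strictly increasing in
the vertical direction, and the profile is the height at which it changes sign, truncated to
`[0, H]`. If `gap R` is positive on `[0, H]` the set is empty and the supremum has the value `0`, as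
it should. -/
noncomputable def profile (H : ℝ) (R : C(Λ, ℝ)) (z : Plane) : ℝ :=
  sSup {s | s ∈ Icc 0 H ∧ gap R (z, s) ≤ 0}

theorem profile_mem {H : ℝ} (hH : 0 ≤ H) (R : C(Λ, ℝ)) (z : Plane) : profile H R z ∈ Icc 0 H :=
  ⟨Real.sSup_nonneg fun _ hs => hs.1.1, Real.sSup_le (fun _ hs => hs.1.2) hH⟩

theorem measurableSet_subgraph {Ω₂ : Set Plane} (hΩ : MeasurableSet Ω₂) {h : Plane → ℝ}
    (hh : Measurable h) : MeasurableSet (subgraph Ω₂ h) :=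
  measurableSet_regionBetween measurable_const hh hΩ

theorem subgraph_congr {Ω₂ : Set Plane} {h h' : Plane → ℝ} (hh : EqOn h h' Ω₂) :
    subgraph Ω₂ h = subgraph Ω₂ h' := by
  ext x
  simp only [subgraph, mem_ofPred_eq]
  constructor
  · rintro ⟨h1, h2, h3⟩
    exact ⟨h1, h2, hh h1 ▸ h3⟩
  · rintro ⟨h1, h2, h3⟩
    exact ⟨h1, h2, (hh h1).symm ▸ h3⟩

theorem subgraph_subset_cylinder {Ω₂ : Set Plane} {H : ℝ} {h : Plane → ℝ}
    (hh : ∀ z ∈ Ω₂, h z ≤ H) : subgraph Ω₂ h ⊆ cylinder Ω₂ H :=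
  fun _ hx => ⟨hx.1, hx.2.1.le, hx.2.2.le.trans (hh _ hx.1)⟩

theorem integrableOn_cylinder {Ω₂ : Set Plane} (hΩ : Bornology.IsBounded Ω₂) (H : ℝ)
    {f : Space → ℝ} (hf : Continuous f) : IntegrableOn f (cylinder Ω₂ H) := by
  obtain ⟨r, hr⟩ := hΩ.subset_closedBall 0
  exact (hf.continuousOn.integrableOn_compact
    ((isCompact_closedBall (0 : Plane) r).prod (isCompact_Icc (a := (0 : ℝ)) (b := H)))).mono_set
    (prod_mono hr subset_rfl)

section Profile

variable [CompactSpace Λ] [Nonempty Λ] {δ : ℝ}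

theorem continuous_gap (R : C(Λ, ℝ)) : Continuous (gap R) := by
  have := continuous_conj R
  unfold gap
  fun_prop

theorem abs_gap_sub_gap_le (R R' : C(Λ, ℝ)) (x : Space) : |gap R x - gap R' x| ≤ ‖R - R'‖ := by
  have := abs_conj_sub_conj_le_norm R' R x
  rw [norm_sub_rev] at this
  unfold gap
  convert this using 2
  ring

theorem gap_vertical (hΛ : ∀ y ∈ Λ, y.2 ≤ -δ) (R : C(Λ, ℝ)) (z : Plane) {s t : ℝ}
    (hst : s ≤ t) : gap R (z, s) + δ * (t - s) ≤ gap R (z, t) := by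
  have := conj_vertical hΛ R z hst
  simp only [gap]
  linarith

theorem gap_le_of_lt_profile {H : ℝ} (hΛ : ∀ y ∈ Λ, y.2 ≤ -δ) (R : C(Λ, ℝ)) {z : Plane}
    {s : ℝ} (hs : 0 ≤ s) (h : s < profile H R z) : gap R (z, s) ≤ -(δ * (profile H R z - s)) := by
  have hne : {s | s ∈ Icc 0 H ∧ gap R (z, s) ≤ 0}.Nonempty := by
    by_contra hemp
    rw [not_nonempty_iff_eq_empty] at hemp
    rw [profile, hemp, Real.sSup_empty] at h
    linarith
  have hcl : IsCompact {s | s ∈ Icc 0 H ∧ gap R (z, s) ≤ 0} := by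
    have hc : Continuous fun s : ℝ => gap R (z, s) := (continuous_gap R).comp (by fun_prop)
    exact isCompact_Icc.inter_right (isClosed_le hc (continuous_const (y := (0 : ℝ))))
  have := (hcl.sSup_mem hne).2
  change gap R (z, profile H R z) ≤ 0 at this
  linarith [gap_vertical hΛ R z h.le]

theorem le_gap_of_profile_le {H : ℝ} (hH : 0 ≤ H) (hΛ : ∀ y ∈ Λ, y.2 ≤ -δ) (R : C(Λ, ℝ))
    {z : Plane} {s : ℝ} (h : profile H R z ≤ s) (hlt : profile H R z < H) :
    δ * (s - profile H R z) ≤ gap R (z, s) := by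
  have h0 : 0 ≤ gap R (z, profile H R z) := by
    have hc : Continuous fun s : ℝ => gap R (z, s) := (continuous_gap R).comp (by fun_prop)
    refine ge_of_tendsto (hc.continuousWithinAt (s := Ioi (profile H R z))) ?_
    filter_upwards [Ioo_mem_nhdsGT hlt] with t ht
    by_contra! hneg
    have : t ≤ profile H R z :=
      le_csSup ⟨H, fun _ hs => hs.1.2⟩ ⟨⟨(profile_mem hH R z).1.trans ht.1.le, ht.2.le⟩, hneg.le⟩
    linarith [ht.1]
  linarith [gap_vertical hΛ R z h]

theorem profile_sub_profile_le {H η : ℝ} (hδ : 0 < δ) (hH : 0 ≤ H) (hΛ : ∀ y ∈ Λ, y.2 ≤ -δ)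
    (R : C(Λ, ℝ)) {z z' : Plane} (hη : 0 ≤ η)
    (hz : ∀ s ∈ Icc 0 H, gap R (z, s) - gap R (z', s) ≤ η) :
    profile H R z' - profile H R z ≤ η / δ := by
  rw [le_div_iff₀ hδ]
  by_contra! hlt
  have hlt' : profile H R z < profile H R z' := by nlinarith
  have hm := profile_mem hH R z
  have hm' := profile_mem hH R z'
  have h1 := le_gap_of_profile_le hH hΛ R le_rfl (hlt'.trans_le hm'.2)
  have h2 := gap_le_of_lt_profile hΛ R hm.1 hlt'
  have h3 := hz _ hm
  nlinarith

/-- The free surface is Lipschitz: horizontally the derivative of `gap R` is at most `B + M`,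
vertically at least `δ`. -/
theorem abs_profile_sub_profile_le {H B M : ℝ} (hδ : 0 < δ) (hH : 0 ≤ H)
    (hΛ : ∀ y ∈ Λ, y.2 ≤ -δ) (hM : ∀ y ∈ Λ, ‖y.1‖ ≤ M) (R : C(Λ, ℝ)) {z z' : Plane}
    (hz : ‖z‖ ≤ B) (hz' : ‖z'‖ ≤ B) :
    |profile H R z - profile H R z'| ≤ (B + M) / δ * ‖z - z'‖ := by
  have hB : 0 ≤ B := (norm_nonneg _).trans hz
  have hM0 : 0 ≤ M := (norm_nonneg _).trans (hM _ (Classical.arbitrary Λ).2)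
  have key : ∀ s, |gap R (z, s) - gap R (z', s)| ≤ (B + M) * ‖z - z'‖ := fun s => by
    have h1 : |conj R (z, s) - conj R (z', s)| ≤ M * ‖z - z'‖ := by
      refine abs_conj_sub_conj_le R fun y hy => (abs_dot_le _ _).trans ?_
      simp only [Prod.mk_sub_mk, sub_self, abs_zero, zero_mul, add_zero]
      rw [mul_comm]
      exact mul_le_mul_of_nonneg_right (hM y hy) (norm_nonneg _)
    have h2 : |‖z‖ ^ 2 / 2 - ‖z'‖ ^ 2 / 2| ≤ B * ‖z - z'‖ := by
      have e : ‖z‖ ^ 2 / 2 - ‖z'‖ ^ 2 / 2 = (‖z‖ + ‖z'‖) / 2 * (‖z‖ - ‖z'‖) := by ring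
      rw [e, abs_mul]
      refine mul_le_mul ?_ (abs_norm_sub_norm_le z z') (abs_nonneg _) hB
      rw [abs_of_nonneg (by positivity)]
      linarith
    simp only [gap]
    rw [abs_le] at *
    constructor <;> linarith [h1.1, h1.2, h2.1, h2.2]
  have h0 : 0 ≤ (B + M) * ‖z - z'‖ := by positivity
  rw [div_mul_eq_mul_div, abs_le]
  have h1 := profile_sub_profile_le hδ hH hΛ R h0 (fun s _ => (abs_le.1 (key s)).2)
  have h2 := profile_sub_profile_le (z := z') (z' := z) hδ hH hΛ R h0
    (fun s _ => by linarith [(abs_le.1 (key s)).1])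
  constructor <;> linarith

theorem continuous_profile {H : ℝ} (hδ : 0 < δ) (hH : 0 ≤ H)
    (hΛ : ∀ y ∈ Λ, y.2 ≤ -δ) (R : C(Λ, ℝ)) : Continuous (profile H R) := by
  obtain ⟨M, hM⟩ := (isCompact_iff_compactSpace.2 ‹CompactSpace Λ›).isBounded.exists_norm_le
  rw [continuous_iff_continuousAt]
  intro z
  rw [ContinuousAt, tendsto_iff_norm_sub_tendsto_zero]
  have hlim : Tendsto (fun z' => (‖z‖ + 1 + M) / δ * ‖z' - z‖) (𝓝 z) (𝓝 0) := by
    have : Tendsto (fun z' => (‖z‖ + 1 + M) / δ * ‖z' - z‖) (𝓝 z)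
        (𝓝 ((‖z‖ + 1 + M) / δ * ‖z - z‖)) := Continuous.tendsto (by fun_prop) z
    simpa using this
  refine squeeze_zero' (Eventually.of_forall fun _ => norm_nonneg _) ?_ hlim
  filter_upwards [Metric.ball_mem_nhds z one_pos] with z' hz'
  rw [Metric.mem_ball, dist_eq_norm] at hz'
  refine abs_profile_sub_profile_le hδ hH hΛ (fun y hy => (norm_fst_le y).trans (hM y hy)) R ?_
    (by linarith)
  linarith [norm_le_norm_add_norm_sub' z' z]

/-- Every vertical line meets `{gap R = 0}` in at most one point. -/
theorem ae_gap_ne_zero (H : ℝ) (hδ : 0 < δ) (hΛ : ∀ y ∈ Λ, y.2 ≤ -δ) (R : C(Λ, ℝ)) :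
    ∀ᵐ x : Space, gap R x ≠ 0 ∧ x.2 ≠ 0 ∧ x.2 ≠ H := by
  have hmeas : MeasurableSet {x : Space | gap R x ≠ 0 ∧ x.2 ≠ 0 ∧ x.2 ≠ H} := by
    have hc := (continuous_gap R).measurable
    exact ((hc (measurableSet_singleton 0)).compl).inter
      ((measurable_snd (measurableSet_singleton 0)).compl.inter
        (measurable_snd (measurableSet_singleton H)).compl)
  have := (Measure.ae_prod_iff_ae_ae (μ := (volume : Measure Plane)) (ν := (volume : Measure ℝ))
    hmeas).2
  refine this (Eventually.of_forall fun z => ?_)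
  have h1 : {s : ℝ | gap R (z, s) = 0}.Subsingleton := by
    have aux : ∀ s t : ℝ, gap R (z, s) = 0 → gap R (z, t) = 0 → s < t → False := by
      intro s t hs ht hlt
      have := gap_vertical hΛ R z hlt.le
      rw [hs, ht] at this
      nlinarith [mul_pos hδ (sub_pos.2 hlt)]
    intro s hs t ht
    rcases lt_trichotomy s t with h | h | h
    · exact (aux s t hs ht h).elim
    · exact h
    · exact (aux t s ht hs h).elim
  have h2 : ∀ᵐ s : ℝ, s ∉ {s : ℝ | gap R (z, s) = 0} := h1.countable.ae_notMem _
  have h3 : ∀ᵐ s : ℝ, s ∉ ({0, H} : Set ℝ) := (Set.toFinite _).countable.ae_notMem _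
  filter_upwards [h2, h3] with s hs hs'
  simp only [mem_insert_iff, mem_singleton_iff, not_or] at hs'
  exact ⟨hs, hs'.1, hs'.2⟩

theorem gap_neg_of_mem_subgraph {Ω₂ : Set Plane} {H : ℝ} (hδ : 0 < δ) (hΛ : ∀ y ∈ Λ, y.2 ≤ -δ)
    (R : C(Λ, ℝ)) {x : Space} (hx : x ∈ subgraph Ω₂ (profile H R)) : gap R x < 0 := by
  have := gap_le_of_lt_profile hΛ R hx.2.1.le hx.2.2
  have h2 := mul_pos hδ (sub_pos.2 hx.2.2)
  change gap R x ≤ _ at this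
  linarith

theorem mem_subgraph_of_gap_neg {Ω₂ : Set Plane} {H : ℝ} (hδ : 0 < δ) (hH : 0 ≤ H)
    (hΛ : ∀ y ∈ Λ, y.2 ≤ -δ) (R : C(Λ, ℝ)) {x : Space} (hx : x ∈ cylinder Ω₂ H)
    (h0 : x.2 ≠ 0) (h1 : x.2 ≠ H) (hg : gap R x < 0) : x ∈ subgraph Ω₂ (profile H R) := by
  refine ⟨hx.1, lt_of_le_of_ne hx.2.1 (Ne.symm h0), ?_⟩
  by_contra! hle
  have := le_gap_of_profile_le hH hΛ R hle (hle.trans_lt (lt_of_le_of_ne hx.2.2 h1))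
  have h2 := mul_nonneg hδ.le (sub_nonneg.2 hle)
  change _ ≤ gap R x at this
  linarith

/-! ### The dual functional on continuous functions -/

theorem setIntegral_min_gap_eq {Ω₂ : Set Plane} (hΩ : MeasurableSet Ω₂) {H : ℝ} (hδ : 0 < δ)
    (hH : 0 ≤ H) (hΛ : ∀ y ∈ Λ, y.2 ≤ -δ) (R : C(Λ, ℝ)) :
    ∫ x in cylinder Ω₂ H, min (gap R x) 0 = ∫ x, gap R x ∂(sigma Ω₂ (profile H R)) := by
  have hm := measurableSet_subgraph hΩ (continuous_profile (H := H) hδ hH hΛ R).measurable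
  have hcyl : MeasurableSet (cylinder Ω₂ H) := hΩ.prod measurableSet_Icc
  have hsub : subgraph Ω₂ (profile H R) ⊆ cylinder Ω₂ H :=
    subgraph_subset_cylinder fun z _ => (profile_mem hH R z).2
  rw [sigma, ← inter_eq_self_of_subset_right hsub, ← setIntegral_indicator hm]
  refine setIntegral_congr_ae hcyl ?_
  filter_upwards [ae_gap_ne_zero H hδ hΛ R] with x hx hxc
  by_cases hxs : x ∈ subgraph Ω₂ (profile H R)
  · rw [indicator_of_mem hxs, min_eq_left (gap_neg_of_mem_subgraph hδ hΛ R hxs).le]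
  · rw [indicator_of_notMem hxs]
    refine min_eq_right ?_
    by_contra! hneg
    exact hxs (mem_subgraph_of_gap_neg hδ hH hΛ R hxc hx.2.1 hx.2.2 hneg)

theorem setIntegral_min_gap_le {Ω₂ : Set Plane} (hΩ : MeasurableSet Ω₂)
    (hΩb : Bornology.IsBounded Ω₂) {H : ℝ} (R : C(Λ, ℝ)) {h : Plane → ℝ} (hm : Measurable h)
    (hh : ∀ z ∈ Ω₂, h z ≤ H) :
    ∫ x in cylinder Ω₂ H, min (gap R x) 0 ≤ ∫ x, gap R x ∂(sigma Ω₂ h) := by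
  have hms := measurableSet_subgraph hΩ hm
  have hcyl : MeasurableSet (cylinder Ω₂ H) := hΩ.prod measurableSet_Icc
  have hsub := subgraph_subset_cylinder hh
  rw [sigma, ← inter_eq_self_of_subset_right hsub, ← setIntegral_indicator hms]
  have hc := continuous_gap R
  refine setIntegral_mono (integrableOn_cylinder hΩb H (by fun_prop))
    ((integrableOn_cylinder hΩb H hc).indicator hms) fun x => ?_
  by_cases hxs : x ∈ subgraph Ω₂ h
  · rw [indicator_of_mem hxs]
    exact min_le_left _ _
  · rw [indicator_of_notMem hxs]
    exact min_le_right _ _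

/-- The dual functional `J_ν^H(conj R, R)`. The infimum over the profiles is replaced by its value,
the integral of the negative part of the gap over the whole cylinder
(see `dualFunctional_eq_dualValue`). -/
noncomputable def dualValue (Ω₂ : Set Plane) (ν : Measure Space) (H : ℝ) (R : C(Λ, ℝ)) : ℝ :=
  (∫ y : Λ, (‖(y : Space).1‖ ^ 2 / 2 - R y) ∂(ν.comap Subtype.val)) +
    ∫ x in cylinder Ω₂ H, min (gap R x) 0

theorem dualFunctional_eq_dualValue {Ω₂ : Set Plane} (hΩ : MeasurableSet Ω₂)
    (hΩb : Bornology.IsBounded Ω₂) {H : ℝ} (hδ : 0 < δ) (hH : 0 ≤ H) (hΛm : MeasurableSet Λ)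
    (hΛ : ∀ y ∈ Λ, y.2 ≤ -δ) (ν : Measure Space) (R : C(Λ, ℝ)) {P R' : Space → ℝ}
    (hP : EqOn P (conj R) (cylinder Ω₂ H)) (hR : ∀ y : Λ, R' y = R y) :
    dualFunctional Ω₂ Λ ν H P R' = dualValue Ω₂ ν H R := by
  have hPi : ∀ h : Plane → ℝ, Measurable h → (∀ z ∈ Ω₂, 0 ≤ h z ∧ h z ≤ H) →
      ∫ x, (‖x.1‖ ^ 2 / 2 - P x) ∂(sigma Ω₂ h) = ∫ x, gap R x ∂(sigma Ω₂ h) := by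
    intro h hm hh
    refine setIntegral_congr_fun (measurableSet_subgraph hΩ hm) fun x hx => ?_
    simp only [gap, hP (subgraph_subset_cylinder (fun z hz => (hh z hz).2) hx)]
  unfold dualFunctional dualValue
  congr 1
  · rw [← integral_subtype_comap hΛm]
    simp only [hR]
  · refine IsLeast.csInf_eq ⟨?_, ?_⟩
    · have hc := (continuous_profile (H := H) hδ hH hΛ R).measurable
      have hb : ∀ z ∈ Ω₂, 0 ≤ profile H R z ∧ profile H R z ≤ H := fun z _ => profile_mem hH R z
      refine ⟨profile H R, hc, hb, ?_⟩
      rw [hPi _ hc hb, setIntegral_min_gap_eq hΩ hδ hH hΛ R]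
    · rintro v ⟨h, hm, hh, rfl⟩
      rw [hPi h hm hh]
      exact setIntegral_min_gap_le hΩ hΩb R hm fun z hz => (hh z hz).2

end Profile

/-! ### Existence of a dual maximizer -/

theorem sub_le_of_isLUB_dot_sub {A : Set Space} {B H : ℝ} (hB : ∀ x ∈ A, ‖x.1‖ ≤ B)
    (hH : ∀ x ∈ A, |x.2| ≤ H) {f : Space → ℝ} {y y' : Space} {r r' : ℝ}
    (hr : IsLUB ((fun x => dot x y - f x) '' A) r)
    (hr' : IsLUB ((fun x => dot x y' - f x) '' A) r') : r - r' ≤ (B + H) * dist y y' := by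
  rw [sub_le_iff_le_add']
  refine hr.2 ?_
  rintro _ ⟨x, hx, rfl⟩
  have h1 : dot x y' - f x ≤ r' := hr'.1 ⟨x, hx, rfl⟩
  have h2 := le_of_abs_le (abs_dot_le x (y - y'))
  rw [← dot_sub_right] at h2
  have h3 : ‖x.1‖ * ‖(y - y').1‖ ≤ B * dist y y' := by
    rw [dist_eq_norm]
    exact mul_le_mul (hB x hx) (norm_fst_le (y - y')) (norm_nonneg _)
      ((norm_nonneg _).trans (hB x hx))
  have h4 : |x.2| * |(y - y').2| ≤ H * dist y y' := by
    rw [dist_eq_norm]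
    exact mul_le_mul (hH x hx) (norm_snd_le (y - y')) (abs_nonneg _)
      ((abs_nonneg _).trans (hH x hx))
  simp only
  linarith

/-- Functions that are transforms over a bounded set are uniformly Lipschitz. -/
theorem abs_sub_le_of_isLUB_dot_sub {A : Set Space} {B H : ℝ} (hB : ∀ x ∈ A, ‖x.1‖ ≤ B)
    (hH : ∀ x ∈ A, |x.2| ≤ H) {f g : Space → ℝ}
    (hg : ∀ y ∈ Λ, IsLUB ((fun x => dot x y - f x) '' A) (g y)) (y y' : Λ) :
    |g y - g y'| ≤ (B + H) * dist y y' := by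
  rw [abs_le]
  have h1 := sub_le_of_isLUB_dot_sub hB hH (hg y y.2) (hg y' y'.2)
  have h2 := sub_le_of_isLUB_dot_sub hB hH (hg y' y'.2) (hg y y.2)
  rw [dist_comm] at h2
  exact ⟨by rw [Subtype.dist_eq]; linarith, h1⟩

theorem continuous_of_abs_sub_le {α : Type*} [PseudoMetricSpace α] {L : ℝ} (hL : 0 ≤ L)
    {g : α → ℝ} (hg : ∀ y y', |g y - g y'| ≤ L * dist y y') : Continuous g :=
  (LipschitzWith.of_dist_le_mul (K := L.toNNReal) fun y y' => by
    rw [Real.coe_toNNReal _ hL, Real.dist_eq]; exact hg y y').continuous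

theorem isCompact_lipschitz_bounded {α : Type*} [MetricSpace α] [CompactSpace α] (L C : ℝ) :
    IsCompact {R : C(α, ℝ) | (∀ y y', |R y - R y'| ≤ L * dist y y') ∧ ∀ y, |R y| ≤ C} := by
  let e := ContinuousMap.isometryEquivBoundedOfCompact α ℝ
  let A : Set (BoundedContinuousFunction α ℝ) :=
    {f | (∀ y y', |f y - f y'| ≤ L * dist y y') ∧ ∀ y, |f y| ≤ C}
  have hA : IsCompact A := by
    refine BoundedContinuousFunction.arzela_ascoli₂ (Icc (-C) C) isCompact_Icc A ?_
      (fun f y hf => abs_le.1 (hf.2 y)) ?_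
    · have h1 : ∀ y, Continuous fun f : BoundedContinuousFunction α ℝ => f y := fun y =>
        continuous_eval_const y
      have c1 : IsClosed {f : BoundedContinuousFunction α ℝ |
          ∀ y y', |f y - f y'| ≤ L * dist y y'} := by
        simp only [ofPred_forall]
        exact isClosed_iInter fun y => isClosed_iInter fun y' =>
          isClosed_le ((h1 y).sub (h1 y')).abs continuous_const
      have c2 : IsClosed {f : BoundedContinuousFunction α ℝ | ∀ y, |f y| ≤ C} := by
        simp only [ofPred_forall]
        exact isClosed_iInter fun y => isClosed_le (h1 y).abs continuous_const
      exact c1.inter c2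
    · refine Metric.equicontinuous_of_continuity_modulus (fun d => L * d) ?_ _ ?_
      · have : Tendsto (fun d : ℝ => L * d) (𝓝 0) (𝓝 (L * 0)) := Continuous.tendsto (by fun_prop) 0
        simpa using this
      · intro y y' f
        rw [Real.dist_eq]
        exact f.2.1 y y'
  have : {R : C(α, ℝ) | (∀ y y', |R y - R y'| ≤ L * dist y y') ∧ ∀ y, |R y| ≤ C} = e.symm '' A := by
    ext R
    constructor
    · intro h
      exact ⟨e R, h, e.symm_apply_apply R⟩
    · rintro ⟨f, hf, rfl⟩
      exact hf
  rw [this]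
  exact hA.image e.symm.continuous

theorem integrable_of_continuous_subtype [CompactSpace Λ] {ν : Measure Space}
    [IsFiniteMeasure (ν.comap (Subtype.val : Λ → Space))] {f : Λ → ℝ} (hf : Continuous f) :
    Integrable f (ν.comap (Subtype.val : Λ → Space)) :=
  hf.integrable_of_hasCompactSupport (HasCompactSupport.of_compactSpace f)

theorem continuous_half_sq_sub (R : C(Λ, ℝ)) :
    Continuous fun y : Λ => ‖(y : Space).1‖ ^ 2 / 2 - R y := by
  have := R.continuous
  fun_prop

theorem volume_cylinder_lt_top {Ω₂ : Set Plane} (hΩb : Bornology.IsBounded Ω₂) (H : ℝ) :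
    volume (cylinder Ω₂ H) < ⊤ :=
  (hΩb.prod (Metric.isBounded_Icc 0 H)).measure_lt_top

section

variable [CompactSpace Λ] [Nonempty Λ] {Ω₂ : Set Plane} {ν : Measure Space}
  [IsProbabilityMeasure (ν.comap (Subtype.val : Λ → Space))]

theorem continuous_dualValue (hΩb : Bornology.IsBounded Ω₂) (H : ℝ) :
    Continuous fun R : C(Λ, ℝ) => dualValue Ω₂ ν H R := by
  have hfin : IsFiniteMeasure (volume.restrict (cylinder Ω₂ H)) :=
    isFiniteMeasure_restrict.2 (volume_cylinder_lt_top hΩb H).ne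
  refine (LipschitzWith.of_le_add_mul' (1 + volume.real (cylinder Ω₂ H)) fun R R' => ?_).continuous
  have h1 : ∫ y : Λ, (‖(y : Space).1‖ ^ 2 / 2 - R y) ∂(ν.comap Subtype.val) ≤
      (∫ y : Λ, (‖(y : Space).1‖ ^ 2 / 2 - R' y) ∂(ν.comap Subtype.val)) + ‖R - R'‖ := by
    have : ∫ y : Λ, (‖(y : Space).1‖ ^ 2 / 2 - R y) ∂(ν.comap Subtype.val) ≤
        ∫ y : Λ, ((‖(y : Space).1‖ ^ 2 / 2 - R' y) + ‖R - R'‖) ∂(ν.comap Subtype.val) := by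
      refine integral_mono (integrable_of_continuous_subtype (continuous_half_sq_sub R))
        (integrable_of_continuous_subtype ((continuous_half_sq_sub R').add continuous_const))
        fun y => ?_
      have := (abs_le.1 ((R - R').norm_coe_le_norm y)).1
      simp only [ContinuousMap.sub_apply] at this
      simp only
      linarith
    rwa [integral_add (integrable_of_continuous_subtype (continuous_half_sq_sub R'))
      (integrable_const _), integral_const, probReal_univ, one_smul] at this
  have hc := continuous_gap R
  have hc' := continuous_gap R'
  have hi' := integrableOn_cylinder (f := fun x => min (gap R' x) 0) hΩb H (by fun_prop)
  have h2 : ∫ x in cylinder Ω₂ H, min (gap R x) 0 ≤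
      (∫ x in cylinder Ω₂ H, min (gap R' x) 0) + volume.real (cylinder Ω₂ H) * ‖R - R'‖ := by
    have : ∫ x in cylinder Ω₂ H, min (gap R x) 0 ≤
        ∫ x in cylinder Ω₂ H, (min (gap R' x) 0 + ‖R - R'‖) := by
      refine integral_mono (integrableOn_cylinder hΩb H (by fun_prop))
        (hi'.add (integrable_const _)) fun x => ?_
      have := (abs_le.1 (abs_gap_sub_gap_le R R' x)).2
      have h0 := norm_nonneg (R - R')
      simp only
      rcases le_total (gap R' x) 0 with h | h
      · rw [min_eq_left h]
        exact (min_le_left _ _).trans (by linarith)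
      · rw [min_eq_right h]
        exact (min_le_right _ _).trans (by linarith)
    rwa [integral_add hi' (integrable_const _), integral_const, measureReal_restrict_apply_univ,
      smul_eq_mul] at this
  rw [dist_eq_norm]
  unfold dualValue
  linarith

/-- Replacing `R` by its double transform over the cylinder does not decrease the dual value:
`R` decreases, while its transform does not change on the cylinder. -/
theorem exists_lipschitz_dualValue_le (hΩ : MeasurableSet Ω₂) (hΩne : Ω₂.Nonempty) {B H : ℝ}
    (hB : ∀ z ∈ Ω₂, ‖z‖ ≤ B) (hH : 0 ≤ H) (R : C(Λ, ℝ)) :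
    ∃ R' : C(Λ, ℝ), (∀ y y', |R' y - R' y'| ≤ (B + H) * dist y y') ∧
      dualValue Ω₂ ν H R ≤ dualValue Ω₂ ν H R' := by
  obtain ⟨z₀, hz₀⟩ := hΩne
  have hBH : 0 ≤ B + H := add_nonneg ((norm_nonneg _).trans (hB z₀ hz₀)) hH
  let g : Space → ℝ := fun y => sSup ((fun x => dot x y - conj R x) '' cylinder Ω₂ H)
  have hle : ∀ y : Λ, ∀ x, dot x y - conj R x ≤ R y := fun y x => by
    linarith [dot_sub_le_conj R x y]
  have hg : ∀ y ∈ Λ, IsLUB ((fun x => dot x y - conj R x) '' cylinder Ω₂ H) (g y) := by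
    intro y hy
    refine isLUB_csSup (Nonempty.image _ ⟨(z₀, 0), hz₀, le_rfl, hH⟩) ⟨R ⟨y, hy⟩, ?_⟩
    rintro _ ⟨x, -, rfl⟩
    exact hle ⟨y, hy⟩ x
  have hlip := abs_sub_le_of_isLUB_dot_sub (B := B) (H := H) (fun x hx => hB _ hx.1)
    (fun x hx => abs_le.2 ⟨by linarith [hx.2.1], hx.2.2⟩) hg
  let R' : C(Λ, ℝ) := ⟨fun y => g y, continuous_of_abs_sub_le hBH hlip⟩
  have hR' : ∀ y, R' y ≤ R y := fun y => (hg y y.2).2 <| by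
    rintro _ ⟨x, -, rfl⟩
    exact hle y x
  have hconj : ∀ x ∈ cylinder Ω₂ H, gap R' x = gap R x := by
    intro x hx
    have h1 : conj R x ≤ conj R' x := by
      simpa using conj_le_conj_add (c := 0) (fun y => by simpa using hR' y) x
    have h2 : conj R' x ≤ conj R x := by
      refine (isLUB_conj R' x).2 ?_
      rintro _ ⟨y, rfl⟩
      have : dot x y - conj R x ≤ R' y := (hg y y.2).1 ⟨x, hx, rfl⟩
      simp only
      linarith
    simp only [gap, le_antisymm h1 h2]
  refine ⟨R', hlip, add_le_add ?_ ?_⟩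
  · have hi : ∀ R : C(Λ, ℝ), Integrable (fun y : Λ => ‖(y : Space).1‖ ^ 2 / 2 - R y)
        (ν.comap (Subtype.val : Λ → Space)) := fun R =>
      integrable_of_continuous_subtype (continuous_half_sq_sub R)
    refine integral_mono (hi R) (hi R') fun y => ?_
    have := hR' y
    simp only
    linarith
  · refine (setIntegral_congr_fun (hΩ.prod measurableSet_Icc) fun x hx => ?_).le
    simp only [hconj x hx]

/-- Coercivity: a Lipschitz function with a large dual value is bounded. Large positive values are
excluded by comparison with the empty region, large negative ones by comparison with the full
cylinder, whose volume exceeds the total mass `1`. -/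
theorem exists_bound_of_le_dualValue (hΩb : Bornology.IsBounded Ω₂) {L H : ℝ}
    (hvol : 1 < volume.real (cylinder Ω₂ H)) (hL : 0 ≤ L) (f : ℝ) :
    ∃ C, ∀ R : C(Λ, ℝ), (∀ y y', |R y - R y'| ≤ L * dist y y') → f ≤ dualValue Ω₂ ν H R →
      ∀ y, |R y| ≤ C := by
  have hfin : IsFiniteMeasure (volume.restrict (cylinder Ω₂ H)) :=
    isFiniteMeasure_restrict.2 (volume_cylinder_lt_top hΩb H).ne
  let y₀ : Λ := Classical.arbitrary Λ
  set V := volume.real (cylinder Ω₂ H) with hV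
  let D := L * Metric.diam (univ : Set Λ)
  let Q := ∫ y : Λ, ‖(y : Space).1‖ ^ 2 / 2 ∂(ν.comap Subtype.val)
  let G := ∫ x in cylinder Ω₂ H, (‖x.1‖ ^ 2 / 2 - dot x y₀)
  refine ⟨max (Q + D - f) (-((f - Q - D - G) / (V - 1))) + D, fun R hR hf y => ?_⟩
  have hD : ∀ y y', |R y - R y'| ≤ D := fun y y' => (hR y y').trans <|
    mul_le_mul_of_nonneg_left
      (Metric.dist_le_diam_of_mem isCompact_univ.isBounded (mem_univ _) (mem_univ _)) hL
  have h1 : ∫ y : Λ, (‖(y : Space).1‖ ^ 2 / 2 - R y) ∂(ν.comap Subtype.val) ≤ Q + (D - R y₀) := by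
    have hq : Integrable (fun y : Λ => ‖(y : Space).1‖ ^ 2 / 2)
        (ν.comap (Subtype.val : Λ → Space)) := integrable_of_continuous_subtype (by fun_prop)
    have : ∫ y : Λ, (‖(y : Space).1‖ ^ 2 / 2 - R y) ∂(ν.comap Subtype.val) ≤
        ∫ y : Λ, (‖(y : Space).1‖ ^ 2 / 2 + (D - R y₀)) ∂(ν.comap Subtype.val) := by
      refine integral_mono (integrable_of_continuous_subtype (continuous_half_sq_sub R))
        (hq.add (integrable_const _)) fun y => ?_
      have := (abs_le.1 (hD y y₀)).1
      simp only
      linarith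
    rwa [integral_add hq (integrable_const _), integral_const, probReal_univ, one_smul] at this
  have hc := continuous_gap R
  have hi := integrableOn_cylinder (f := fun x => min (gap R x) 0) hΩb H (by fun_prop)
  have h2 : ∫ x in cylinder Ω₂ H, min (gap R x) 0 ≤ 0 :=
    integral_nonpos fun x => min_le_right _ _
  have h3 : ∫ x in cylinder Ω₂ H, min (gap R x) 0 ≤ G + V * R y₀ := by
    have hd : Continuous fun x : Space => dot x y₀ :=
      continuous_dot.comp (continuous_id.prodMk continuous_const)
    have hG : IntegrableOn (fun x : Space => ‖x.1‖ ^ 2 / 2 - dot x y₀) (cylinder Ω₂ H) :=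
      integrableOn_cylinder hΩb H (by fun_prop)
    have : ∫ x in cylinder Ω₂ H, min (gap R x) 0 ≤
        ∫ x in cylinder Ω₂ H, ((‖x.1‖ ^ 2 / 2 - dot x y₀) + R y₀) := by
      refine integral_mono hi (hG.add (integrable_const _)) fun x => (min_le_left _ _).trans ?_
      have := dot_sub_le_conj R x y₀
      simp only [gap]
      linarith
    rwa [integral_add hG (integrable_const _), integral_const, measureReal_restrict_apply_univ,
      smul_eq_mul, ← hV] at this
  unfold dualValue at hf
  have h4 : R y₀ ≤ Q + D - f := by linarith
  have h5 : (f - Q - D - G) / (V - 1) ≤ R y₀ := by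
    rw [div_le_iff₀ (by linarith)]
    linarith
  have h6 := abs_le.1 (hD y y₀)
  have h7 := le_max_left (Q + D - f) (-((f - Q - D - G) / (V - 1)))
  have h8 := le_max_right (Q + D - f) (-((f - Q - D - G) / (V - 1)))
  rw [abs_le]
  constructor <;> linarith [h6.1, h6.2]

theorem exists_dualValue_maximizer (hΩ : MeasurableSet Ω₂) (hΩne : Ω₂.Nonempty)
    (hΩb : Bornology.IsBounded Ω₂) {H : ℝ} (hH : 0 ≤ H)
    (hvol : 1 < volume.real (cylinder Ω₂ H)) :
    ∃ R : C(Λ, ℝ), ∀ R' : C(Λ, ℝ), dualValue Ω₂ ν H R' ≤ dualValue Ω₂ ν H R := by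
  obtain ⟨B, hB⟩ := hΩb.exists_norm_le
  have hBH : 0 ≤ B + H := add_nonneg ((norm_nonneg _).trans (hB _ hΩne.some_mem)) hH
  obtain ⟨R₀, hR₀, hle₀⟩ := exists_lipschitz_dualValue_le (ν := ν) hΩ hΩne hB hH (0 : C(Λ, ℝ))
  obtain ⟨C, hC⟩ := exists_bound_of_le_dualValue (Λ := Λ) (ν := ν) hΩb hvol hBH
    (dualValue Ω₂ ν H (0 : C(Λ, ℝ)))
  obtain ⟨R, hR, hmax⟩ := (isCompact_lipschitz_bounded (B + H) C).exists_isMaxOn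
    ⟨R₀, hR₀, hC R₀ hR₀ hle₀⟩ (continuous_dualValue (ν := ν) hΩb H).continuousOn
  refine ⟨R, fun R' => ?_⟩
  obtain ⟨R'', hR'', hle⟩ := exists_lipschitz_dualValue_le (ν := ν) hΩ hΩne hB hH R'
  refine hle.trans ?_
  rcases le_total (dualValue Ω₂ ν H (0 : C(Λ, ℝ))) (dualValue Ω₂ ν H R'') with h | h
  · exact hmax ⟨hR'', hC R'' hR'' h⟩
  · exact (h.trans hle₀).trans (hmax ⟨hR₀, hC R₀ hR₀ hle₀⟩)

end

/-! ### The Euler–Lagrange equation of the dual problem -/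

theorem isFiniteMeasure_sigma_profile {Ω₂ : Set Plane} (hΩb : Bornology.IsBounded Ω₂)
    {H : ℝ} (hH : 0 ≤ H) (R : C(Λ, ℝ)) : IsFiniteMeasure (sigma Ω₂ (profile H R)) :=
  isFiniteMeasure_restrict.2 ((measure_mono
    (subgraph_subset_cylinder fun z _ => (profile_mem hH R z).2)).trans_lt
      (volume_cylinder_lt_top hΩb H)).ne

section

variable [CompactSpace Λ] [Nonempty Λ] {Ω₂ : Set Plane} {ν : Measure Space}
  [IsProbabilityMeasure (ν.comap (Subtype.val : Λ → Space))]

theorem abs_min_gap_sub_min_gap_le (R R' : C(Λ, ℝ)) (x : Space) :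
    |min (gap R x) 0 - min (gap R' x) 0| ≤ ‖R - R'‖ :=
  (abs_min_sub_min_le_max _ _ _ _).trans <| by
    simpa using abs_gap_sub_gap_le R R' x

theorem tendsto_gap_add_smul (R φ : C(Λ, ℝ)) (x : Space) :
    Tendsto (fun ε : ℝ => gap (R + ε • φ) x) (𝓝[>] 0) (𝓝 (gap R x)) := by
  have h1 : Continuous fun R : C(Λ, ℝ) => gap R x :=
    (LipschitzWith.of_dist_le_mul (K := 1) fun R R' => by
      rw [Real.dist_eq, dist_eq_norm, NNReal.coe_one, one_mul]
      exact abs_gap_sub_gap_le R R' x).continuous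
  have h2 : Continuous fun ε : ℝ => gap (R + ε • φ) x := h1.comp (by fun_prop)
  have := h2.tendsto 0
  simp only [zero_smul, add_zero] at this
  exact this.mono_left nhdsWithin_le_nhds

/-- The one-sided derivative of the integrand of the dual functional in the direction `φ`. -/
theorem ae_tendsto_min_gap_quotient {δ : ℝ} (hδ : 0 < δ) {H : ℝ} (hH : 0 ≤ H)
    (hΛ : ∀ y ∈ Λ, y.2 ≤ -δ) (R : C(Λ, ℝ)) (φ : Space → ℝ) (φΛ : C(Λ, ℝ)) (hφ : ∀ y, φΛ y = φ y) :
    ∀ᵐ x : Space, x ∈ cylinder Ω₂ H →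
      Tendsto (fun ε : ℝ => (min (gap (R + ε • φΛ) x) 0 - min (gap R x) 0) / ε) (𝓝[>] 0)
        (𝓝 ((subgraph Ω₂ (profile H R)).indicator (fun x => φ (gradConj R x)) x)) := by
  filter_upwards [ae_gap_ne_zero H hδ hΛ R, ae_eq_gradConj R] with x hx huniq hxc
  by_cases hxs : x ∈ subgraph Ω₂ (profile H R)
  · have hneg := gap_neg_of_mem_subgraph hδ hΛ R hxs
    obtain ⟨y, hy⟩ := exists_conj_eq R x
    have hlim := tendsto_conj_quotient R φΛ hy fun y' hy' =>
      Subtype.ext ((huniq y' hy').trans (huniq y hy).symm)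
    rw [indicator_of_mem hxs, ← huniq y hy, ← hφ]
    refine hlim.congr' ?_
    filter_upwards [(tendsto_gap_add_smul R φΛ x).eventually_lt_const hneg] with ε hε
    rw [min_eq_left hε.le, min_eq_left hneg.le]
    simp only [gap]
    ring
  · have hpos : 0 < gap R x := by
      refine lt_of_le_of_ne ?_ (Ne.symm hx.1)
      by_contra! hneg
      exact hxs (mem_subgraph_of_gap_neg hδ hH hΛ R hxc hx.2.1 hx.2.2 hneg)
    rw [indicator_of_notMem hxs]
    refine tendsto_const_nhds.congr' ?_
    filter_upwards [(tendsto_gap_add_smul R φΛ x).eventually_const_lt hpos] with ε hε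
    rw [min_eq_right hε.le, min_eq_right hpos.le, sub_self, zero_div]

theorem integral_comp_gradConj_le (hΩ : MeasurableSet Ω₂) (hΩb : Bornology.IsBounded Ω₂)
    {δ H : ℝ} (hδ : 0 < δ) (hH : 0 ≤ H) (hΛ : ∀ y ∈ Λ, y.2 ≤ -δ) {R : C(Λ, ℝ)}
    (hmax : ∀ R' : C(Λ, ℝ), dualValue Ω₂ ν H R' ≤ dualValue Ω₂ ν H R)
    {φ : Space → ℝ} (hφ : Continuous φ) :
    ∫ x, φ (gradConj R x) ∂(sigma Ω₂ (profile H R)) ≤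
      ∫ y : Λ, φ y ∂(ν.comap Subtype.val) := by
  have hfin : IsFiniteMeasure (volume.restrict (cylinder Ω₂ H)) :=
    isFiniteMeasure_restrict.2 (volume_cylinder_lt_top hΩb H).ne
  have hcyl : MeasurableSet (cylinder Ω₂ H) := hΩ.prod measurableSet_Icc
  have hms := measurableSet_subgraph hΩ (continuous_profile (H := H) hδ hH hΛ R).measurable
  let φΛ : C(Λ, ℝ) := ⟨fun y => φ y, hφ.comp continuous_subtype_val⟩
  let g : ℝ → Space → ℝ := fun ε x => (min (gap (R + ε • φΛ) x) 0 - min (gap R x) 0) / ε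
  have hcont : ∀ R : C(Λ, ℝ), Continuous fun x => min (gap R x) 0 := fun R =>
    (continuous_gap R).min continuous_const
  have hi : ∀ R : C(Λ, ℝ), IntegrableOn (fun x => min (gap R x) 0) (cylinder Ω₂ H) := fun R =>
    integrableOn_cylinder hΩb H (hcont R)
  have hlim : Tendsto (fun ε => ∫ x in cylinder Ω₂ H, g ε x) (𝓝[>] 0)
      (𝓝 (∫ x in cylinder Ω₂ H,
        (subgraph Ω₂ (profile H R)).indicator (fun x => φ (gradConj R x)) x)) := by
    refine tendsto_integral_filter_of_dominated_convergence (fun _ => ‖φΛ‖) ?_ ?_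
      (integrable_const _) ?_
    · refine Eventually.of_forall fun ε => Continuous.aestronglyMeasurable ?_
      exact ((hcont _).sub (hcont _)).div_const _
    · filter_upwards [self_mem_nhdsWithin] with ε hε
      refine Eventually.of_forall fun x => ?_
      have h1 := abs_min_gap_sub_min_gap_le (R + ε • φΛ) R x
      rw [add_sub_cancel_left, norm_smul, Real.norm_eq_abs] at h1
      rw [norm_div, Real.norm_eq_abs, Real.norm_eq_abs, div_le_iff₀ (abs_pos.2 (ne_of_gt hε))]
      linarith
    · exact (ae_restrict_iff' hcyl).2
        (ae_tendsto_min_gap_quotient hδ hH hΛ R φ φΛ fun _ => rfl)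
  have hle : ∀ᶠ ε in 𝓝[>] (0 : ℝ), ∫ x in cylinder Ω₂ H, g ε x ≤
      ∫ y : Λ, φ y ∂(ν.comap Subtype.val) := by
    filter_upwards [self_mem_nhdsWithin] with ε hε
    have h1 := hmax (R + ε • φΛ)
    have h2 : ∫ y : Λ, (‖(y : Space).1‖ ^ 2 / 2 - (R + ε • φΛ) y) ∂(ν.comap Subtype.val) =
        (∫ y : Λ, (‖(y : Space).1‖ ^ 2 / 2 - R y) ∂(ν.comap Subtype.val)) -
          ε * ∫ y : Λ, φ y ∂(ν.comap Subtype.val) := by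
      have hφi : Integrable (fun y : Λ => ε * φ y) (ν.comap Subtype.val) :=
        integrable_of_continuous_subtype ((hφ.comp continuous_subtype_val).const_mul ε)
      rw [← integral_const_mul, ← integral_sub
        (integrable_of_continuous_subtype (continuous_half_sq_sub R)) hφi]
      congr 1
      ext y
      simp only [ContinuousMap.add_apply, ContinuousMap.smul_apply, smul_eq_mul, φΛ,
        ContinuousMap.coe_mk]
      ring
    simp only [g]
    rw [integral_div, integral_sub (hi _) (hi _), div_le_iff₀ hε]
    unfold dualValue at h1
    rw [h2] at h1
    linarith
  have := le_of_tendsto hlim hle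
  rwa [setIntegral_indicator hms, inter_eq_self_of_subset_right
    (subgraph_subset_cylinder fun z _ => (profile_mem hH R z).2)] at this

/-- The Euler–Lagrange equation: at a maximizer `R`, the gradient of `conj R` transports `σ_h` to
`ν`, where `h` is the profile of `R`. -/
theorem map_gradConj_eq [IsProbabilityMeasure ν] (hΛm : MeasurableSet Λ) (hν : ∀ᵐ y ∂ν, y ∈ Λ)
    (hΩ : MeasurableSet Ω₂) (hΩb : Bornology.IsBounded Ω₂)
    {δ H : ℝ} (hδ : 0 < δ) (hH : 0 ≤ H) (hΛ : ∀ y ∈ Λ, y.2 ≤ -δ) {R : C(Λ, ℝ)}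
    (hmax : ∀ R' : C(Λ, ℝ), dualValue Ω₂ ν H R' ≤ dualValue Ω₂ ν H R) :
    (sigma Ω₂ (profile H R)).map (gradConj R) = ν := by
  have := isFiniteMeasure_sigma_profile hΩb hH R
  refine ext_of_forall_integral_eq_of_IsFiniteMeasure fun f => ?_
  have hT := measurable_gradConj R
  have key : ∀ f : Space → ℝ, Continuous f →
      ∫ x, f (gradConj R x) ∂(sigma Ω₂ (profile H R)) ≤ ∫ y, f y ∂ν := fun f hf => by
    refine (integral_comp_gradConj_le hΩ hΩb hδ hH hΛ hmax hf).trans_eq ?_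
    rw [integral_subtype_comap hΛm, Measure.restrict_eq_self_of_ae_mem hν]
  rw [integral_map hT.aemeasurable f.continuous.aestronglyMeasurable]
  refine le_antisymm (key f f.continuous) ?_
  have := key (fun y => -f y) f.continuous.neg
  rw [integral_neg, integral_neg] at this
  linarith

end

/-! ### The height bound keeps the free surface below the lid -/

theorem integral_eq_one_of_volume_subgraph {Ω₂ : Set Plane} (hΩ : MeasurableSet Ω₂)
    {h : Plane → ℝ} (h0 : ∀ z ∈ Ω₂, 0 ≤ h z) (hi : IntegrableOn h Ω₂)
    (hv : volume (subgraph Ω₂ h) = 1) : ∫ z in Ω₂, h z = 1 := by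
  have hreg : volume (subgraph Ω₂ h) = ENNReal.ofReal (∫ z in Ω₂, (h z - 0)) :=
    volume_regionBetween_eq_integral (μ := (volume : Measure Plane)) (f := fun _ => 0)
      integrableOn_zero hi hΩ h0
  rw [hv, eq_comm, ENNReal.ofReal_eq_one] at hreg
  simpa using hreg

theorem norm_le_abs_add_abs (z : Plane) : ‖z‖ ≤ |z 0| + |z 1| := by
  rw [EuclideanSpace.norm_eq, Fin.sum_univ_two]
  refine Real.sqrt_le_iff.2 ⟨by positivity, ?_⟩
  simp only [Real.norm_eq_abs]
  nlinarith [abs_nonneg (z 0), abs_nonneg (z 1)]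

theorem two_div_le_heightBound {Ω₂ : Set Plane} {δ : ℝ} (hδ : 0 < δ) :
    2 / volume.real Ω₂ ≤ heightBound Ω₂ Λ δ := by
  unfold heightBound
  refine le_add_of_nonneg_right
    (mul_nonneg (div_nonneg (add_nonneg ?_ ?_) hδ.le) Metric.diam_nonneg)
  · refine mul_nonneg zero_le_two (Real.sSup_nonneg ?_)
    rintro _ ⟨z, -, rfl⟩
    exact norm_nonneg z
  · refine Real.sSup_nonneg ?_
    rintro _ ⟨y, -, rfl⟩
    positivity

/-- A profile of integral one is somewhere at most its mean `1 / |Ω₂|`, and by its Lipschitz bound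
it cannot climb from there to the height `H`. -/
theorem profile_lt [CompactSpace Λ] [Nonempty Λ] {Ω₂ : Set Plane} {δ H : ℝ}
    (hΩ : IsOpen Ω₂) (hΩne : Ω₂.Nonempty) (hΩb : Bornology.IsBounded Ω₂)
    (hδ : 0 < δ) (hH0 : 0 ≤ H) (hH : heightBound Ω₂ Λ δ < H) (hΛ : ∀ y ∈ Λ, y.2 ≤ -δ)
    (R : C(Λ, ℝ)) (hone : ∫ z in Ω₂, profile H R z = 1)
    (hi : IntegrableOn (profile H R) Ω₂) {z : Plane} (hz : z ∈ Ω₂) : profile H R z < H := by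
  have hvpos : volume Ω₂ ≠ 0 := (hΩ.measure_pos volume hΩne).ne'
  have hvfin : volume Ω₂ ≠ ⊤ := hΩb.measure_lt_top.ne
  obtain ⟨z₀, hz₀, hle⟩ := exists_le_setAverage hvpos hvfin hi
  rw [setAverage_eq, hone, smul_eq_mul, mul_one] at hle
  have hV : 0 < volume.real Ω₂ := ENNReal.toReal_pos hvpos hvfin
  set B := sSup ((fun x : Plane => ‖x‖) '' Ω₂) with hBdef
  set M := sSup ((fun y : Space => |y.1 0| + |y.1 1|) '' Λ) with hMdef
  have hB : ∀ z ∈ Ω₂, ‖z‖ ≤ B := by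
    intro z hz
    obtain ⟨C, hC⟩ := hΩb.exists_norm_le
    refine le_csSup ⟨C, ?_⟩ ⟨z, hz, rfl⟩
    rintro _ ⟨z, hz, rfl⟩
    exact hC z hz
  have hM : ∀ y ∈ Λ, ‖y.1‖ ≤ M := by
    intro y hy
    have hc : Continuous fun y : Space => |y.1 0| + |y.1 1| := by fun_prop
    have hcomp : IsCompact Λ := isCompact_iff_compactSpace.2 ‹_›
    exact (norm_le_abs_add_abs y.1).trans
      (le_csSup (hcomp.image hc).bddAbove ⟨y, hy, rfl⟩)
  have hB0 : 0 ≤ B := (norm_nonneg _).trans (hB z hz)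
  have hM0 : 0 ≤ M := (norm_nonneg _).trans (hM _ (Classical.arbitrary Λ).2)
  have h1 := (abs_le.1 (abs_profile_sub_profile_le hδ hH0 hΛ hM R (hB z hz) (hB z₀ hz₀))).2
  have h2 : (B + M) / δ * ‖z - z₀‖ ≤ (2 * B + M) / δ * Metric.diam Ω₂ := by
    rw [← dist_eq_norm]
    refine mul_le_mul ?_ (Metric.dist_le_diam_of_mem hΩb hz hz₀) dist_nonneg (by positivity)
    gcongr
    linarith
  have h3 : (volume.real Ω₂)⁻¹ ≤ 2 / volume.real Ω₂ := by
    rw [inv_eq_one_div]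
    gcongr
    norm_num
  have h4 : heightBound Ω₂ Λ δ =
      2 / volume.real Ω₂ + (2 * B + M) / δ * Metric.diam Ω₂ := rfl
  linarith

/-! ### Comparison of the optimal region with other regions -/

theorem isOpen_between {Ω₂ : Set Plane} (hΩ : IsOpen Ω₂) {f g : Plane → ℝ}
    (hf : ContinuousOn f Ω₂) (hg : ContinuousOn g Ω₂) :
    IsOpen {x : Space | x.1 ∈ Ω₂ ∧ f x.1 < x.2 ∧ x.2 < g x.1} := by
  have hU : IsOpen (Ω₂ ×ˢ (univ : Set ℝ)) := hΩ.prod isOpen_univ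
  have hc : ∀ f : Plane → ℝ, ContinuousOn f Ω₂ →
      ContinuousOn (fun x : Space => x.2 - f x.1) (Ω₂ ×ˢ (univ : Set ℝ)) := fun f hf =>
    continuousOn_snd.sub (hf.comp continuousOn_fst fun x hx => hx.1)
  have h1 := (hc f hf).isOpen_inter_preimage hU (isOpen_Ioi (a := (0 : ℝ)))
  have h2 := (hc g hg).isOpen_inter_preimage hU (isOpen_Iio (a := (0 : ℝ)))
  convert h1.inter h2 using 1
  ext x
  simp only [mem_ofPred_eq, mem_inter_iff, mem_prod, mem_univ, and_true, mem_preimage, mem_Ioi,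
    mem_Iio, sub_pos, sub_neg]
  tauto

theorem isOpen_subgraph {Ω₂ : Set Plane} (hΩ : IsOpen Ω₂) {h : Plane → ℝ}
    (hh : ContinuousOn h Ω₂) : IsOpen (subgraph Ω₂ h) :=
  isOpen_between hΩ continuousOn_const hh

theorem eq_empty_of_setIntegral_nonpos {T U : Set Space} (hT : MeasurableSet T) (hU : IsOpen U)
    (hUT : U ⊆ T) {f : Space → ℝ} (hf : IntegrableOn f T) (h0 : ∀ x ∈ T, 0 ≤ f x)
    (hpos : ∀ x ∈ U, 0 < f x) (hint : ∫ x in T, f x ≤ 0) : U = ∅ := by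
  have hz : ∫ x in T, f x = 0 := le_antisymm hint (setIntegral_nonneg hT h0)
  rw [setIntegral_eq_zero_iff_of_nonneg_ae ((ae_restrict_iff' hT).2 (Eventually.of_forall h0)) hf]
    at hz
  have : volume U = 0 := by
    have h1 : ∀ᵐ x, x ∈ T → f x = 0 := (ae_restrict_iff' hT).1 hz
    refine measure_mono_null (fun x hx => ?_) (ae_iff.1 h1)
    exact fun h => (hpos x hx).ne' (h (hUT hx))
  exact (hU.measure_eq_zero_iff volume).1 this

section

variable [CompactSpace Λ] [Nonempty Λ] {Ω₂ : Set Plane} {δ H : ℝ}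

theorem integrable_gap_profile (hΩb : Bornology.IsBounded Ω₂) (hH : 0 ≤ H) (R : C(Λ, ℝ)) :
    Integrable (gap R) (sigma Ω₂ (profile H R)) :=
  (integrableOn_cylinder hΩb H (continuous_gap R)).mono_set
    (subgraph_subset_cylinder fun z _ => (profile_mem hH R z).2)

/-- Among all regions below the graph of a continuous function, the one below the profile of `R` has
the least integral of `gap R`, and it is the only one: it is the region where `gap R` is
negative. -/
theorem integral_gap_profile_le (hΩ : IsOpen Ω₂) (hΩb : Bornology.IsBounded Ω₂) (hδ : 0 < δ)
    (hH : 0 ≤ H) (hΛ : ∀ y ∈ Λ, y.2 ≤ -δ) (R : C(Λ, ℝ)) (hlt : ∀ z ∈ Ω₂, profile H R z < H)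
    {h : Plane → ℝ} (h0 : ∀ z ∈ Ω₂, 0 ≤ h z) (hc : ContinuousOn h Ω₂)
    (hi : Integrable (gap R) (sigma Ω₂ h)) :
    ∫ x, gap R x ∂(sigma Ω₂ (profile H R)) ≤ ∫ x, gap R x ∂(sigma Ω₂ h) ∧
      (∫ x, gap R x ∂(sigma Ω₂ h) ≤ ∫ x, gap R x ∂(sigma Ω₂ (profile H R)) →
        EqOn h (profile H R) Ω₂) := by
  have hpc : ContinuousOn (profile H R) Ω₂ := (continuous_profile hδ hH hΛ R).continuousOn
  have hip : IntegrableOn (gap R) (subgraph Ω₂ (profile H R)) := integrable_gap_profile hΩb hH R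
  have hi' : IntegrableOn (gap R) (subgraph Ω₂ h) := hi
  have hS := (isOpen_subgraph hΩ hpc).measurableSet
  have hS' := (isOpen_subgraph hΩ hc).measurableSet
  set S := subgraph Ω₂ (profile H R) with hSdef
  set S' := subgraph Ω₂ h with hSdef'
  have habove : ∀ x : Space, x.1 ∈ Ω₂ → profile H R x.1 ≤ x.2 →
      δ * (x.2 - profile H R x.1) ≤ gap R x := fun x hx hle =>
    le_gap_of_profile_le hH hΛ R hle (hlt _ hx)
  have e1 : (∫ x in S' ∩ S, gap R x) + (∫ x in S' \ S, gap R x) = ∫ x in S', gap R x :=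
    integral_inter_add_sdiff hS hi'
  have e2 : (∫ x in S' ∩ S, gap R x) + (∫ x in S \ S', gap R x) = ∫ x in S, gap R x := by
    rw [inter_comm]
    exact integral_inter_add_sdiff hS' hip
  have n1 : ∀ x ∈ S' \ S, 0 ≤ gap R x := by
    intro x hx
    have hle : profile H R x.1 ≤ x.2 := by
      by_contra! hlt
      exact hx.2 ⟨hx.1.1, hx.1.2.1, hlt⟩
    exact (mul_nonneg hδ.le (sub_nonneg.2 hle)).trans (habove x hx.1.1 hle)
  have n2 : ∀ x ∈ S \ S', 0 ≤ -gap R x := fun x hx =>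
    (neg_pos.2 (gap_neg_of_mem_subgraph hδ hΛ R hx.1)).le
  have i1 : 0 ≤ ∫ x in S' \ S, gap R x := setIntegral_nonneg (hS'.diff hS) n1
  have i2 : 0 ≤ ∫ x in S \ S', -gap R x := setIntegral_nonneg (hS.diff hS') n2
  have e3 : ∫ x in S \ S', -gap R x = -∫ x in S \ S', gap R x := integral_neg _
  change ∫ x in S, gap R x ≤ ∫ x in S', gap R x ∧
    (∫ x in S', gap R x ≤ ∫ x in S, gap R x → EqOn h (profile H R) Ω₂)
  refine ⟨by linarith, fun hle => ?_⟩
  -- In case of equality the open sets between the two graphs are empty, since the gap has a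
  -- strict sign there.
  have z1 := eq_empty_of_setIntegral_nonpos (hS'.diff hS) (isOpen_between hΩ hpc hc)
    (fun x hx => ⟨⟨hx.1, (profile_mem hH R x.1).1.trans_lt hx.2.1, hx.2.2⟩,
      fun hxS => (hxS.2.2.trans hx.2.1).false⟩)
    (hi'.mono_set sdiff_subset) n1
    (fun x hx => (mul_pos hδ (sub_pos.2 hx.2.1)).trans_le (habove x hx.1 hx.2.1.le)) (by linarith)
  have z2 := eq_empty_of_setIntegral_nonpos (hS.diff hS') (isOpen_between hΩ hc hpc)
    (fun x hx => ⟨⟨hx.1, (h0 x.1 hx.1).trans_lt hx.2.1, hx.2.2⟩,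
      fun hxS => (hxS.2.2.trans hx.2.1).false⟩)
    (hip.mono_set sdiff_subset).neg (f := fun x => -gap R x) n2
    (fun x hx => neg_pos.2 (gap_neg_of_mem_subgraph hδ hΛ R
      ⟨hx.1, (h0 x.1 hx.1).trans_lt hx.2.1, hx.2.2⟩)) (by linarith)
  intro z hz
  rcases lt_trichotomy (h z) (profile H R z) with hzlt | hzeq | hzgt
  · obtain ⟨s, hs1, hs2⟩ := exists_between hzlt
    exact ((Set.eq_empty_iff_forall_notMem.1 z2 (z, s)) ⟨hz, hs1, hs2⟩).elim
  · exact hzeq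
  · obtain ⟨s, hs1, hs2⟩ := exists_between hzgt
    exact ((Set.eq_empty_iff_forall_notMem.1 z1 (z, s)) ⟨hz, hs1, hs2⟩).elim

theorem exists_neg_le_gap (hΩb : Bornology.IsBounded Ω₂) (hδ : 0 < δ) (hΛ : ∀ y ∈ Λ, y.2 ≤ -δ)
    (R : C(Λ, ℝ)) : ∃ m : ℝ, 0 ≤ m ∧ ∀ x : Space, x.1 ∈ Ω₂ → 0 ≤ x.2 → -m ≤ gap R x := by
  obtain ⟨r, hr⟩ := hΩb.subset_closedBall 0
  obtain ⟨m, hm⟩ := (isCompact_closedBall (0 : Plane) r).exists_bound_of_continuousOn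
    (f := fun z => gap R (z, 0)) ((continuous_gap R).comp (by fun_prop)).continuousOn
  refine ⟨max m 0, le_max_right _ _, fun x hx hx0 => ?_⟩
  have h1 := (abs_le.1 (hm x.1 (hr hx))).1
  have h2 : gap R (x.1, 0) + δ * (x.2 - 0) ≤ gap R x := gap_vertical hΛ R x.1 hx0
  have h3 := mul_nonneg hδ.le hx0
  have := le_max_left m 0
  rw [sub_zero] at h2
  linarith

end

/-! ### Duality and the primal problem -/

/-- The transport plan `(id × ∇P)_# σ_h` for `P = conj R` and `h` the profile of `R`. -/
noncomputable def plan (Ω₂ : Set Plane) (H : ℝ) (R : C(Λ, ℝ)) : Measure (Space × Space) :=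
  (sigma Ω₂ (profile H R)).map fun x => (x, gradConj R x)

theorem measurable_graph_gradConj (R : C(Λ, ℝ)) :
    Measurable fun x : Space => (x, gradConj R x) :=
  measurable_id.prodMk (measurable_gradConj R)

theorem map_fst_plan (Ω₂ : Set Plane) (H : ℝ) (R : C(Λ, ℝ)) :
    (plan Ω₂ H R).map Prod.fst = sigma Ω₂ (profile H R) := by
  rw [plan, Measure.map_map measurable_fst (measurable_graph_gradConj R)]
  exact Measure.map_id

theorem map_snd_plan (Ω₂ : Set Plane) (H : ℝ) (R : C(Λ, ℝ)) :
    (plan Ω₂ H R).map Prod.snd = (sigma Ω₂ (profile H R)).map (gradConj R) := by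
  rw [plan, Measure.map_map measurable_snd (measurable_graph_gradConj R)]
  rfl

theorem exists_continuous_extension [CompactSpace Λ] (R : C(Λ, ℝ)) :
    ∃ r : Space → ℝ, Continuous r ∧ ∀ y : Λ, r y = R y := by
  have hcl : IsClosed Λ := (isCompact_iff_compactSpace.2 ‹CompactSpace Λ›).isClosed
  obtain ⟨g, hg⟩ := R.exists_restrict_eq hcl
  exact ⟨g, g.continuous, fun y => by rw [← hg]; rfl⟩

/-- Weak duality, pointwise: the cost minus the two dual integrands is the slack in the Young
inequality `x · y ≤ conj R x + R y`. -/
theorem cost_eq_gap_add {R : C(Λ, ℝ)} {r : Space → ℝ} (hr : ∀ y : Λ, r y = R y) (x : Space)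
    (y : Λ) : cost x y =
      gap R x + (‖(y : Space).1‖ ^ 2 / 2 - r y) + (conj R x + R y - dot x y) := by
  rw [cost_eq, gap, hr]
  ring

theorem integrable_half_sq_sub [CompactSpace Λ] {ν : Measure Space} [IsFiniteMeasure ν]
    (hν : ∀ᵐ y ∂ν, y ∈ Λ) {r : Space → ℝ} (hr : Continuous r) :
    Integrable (fun y : Space => ‖y.1‖ ^ 2 / 2 - r y) ν := by
  have hcomp : IsCompact Λ := isCompact_iff_compactSpace.2 ‹_›
  have hc : Continuous fun y : Space => ‖y.1‖ ^ 2 / 2 - r y := by fun_prop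
  have := hc.continuousOn.integrableOn_compact (μ := ν) hcomp
  rwa [IntegrableOn, Measure.restrict_eq_self_of_ae_mem hν] at this

namespace IsAdmissible

variable {Ω₂ : Set Plane} {ν : Measure Space} {h : Plane → ℝ} {γ : Measure (Space × Space)}

theorem isProbabilityMeasure [IsProbabilityMeasure ν] (hγ : IsAdmissible Ω₂ ν h γ) :
    IsProbabilityMeasure γ := by
  have : IsProbabilityMeasure (γ.map Prod.snd) := hγ.snd_marginal ▸ inferInstance
  exact Measure.isProbabilityMeasure_of_map Prod.snd

theorem ae_mem (hγ : IsAdmissible Ω₂ ν h γ) (hΩ : IsOpen Ω₂) (hν : ∀ᵐ y ∂ν, y ∈ Λ) :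
    ∀ᵐ q ∂γ, q.1 ∈ subgraph Ω₂ h ∧ q.2 ∈ Λ := by
  have h1 : ∀ᵐ x ∂(γ.map Prod.fst), x ∈ subgraph Ω₂ h := by
    rw [hγ.fst_marginal, sigma]
    exact ae_restrict_mem (isOpen_subgraph hΩ hγ.continuousOn).measurableSet
  have h2 : ∀ᵐ y ∂(γ.map Prod.snd), y ∈ Λ := hγ.snd_marginal ▸ hν
  filter_upwards [ae_of_ae_map measurable_fst.aemeasurable h1,
    ae_of_ae_map measurable_snd.aemeasurable h2] with q hq1 hq2 using ⟨hq1, hq2⟩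

variable {δ : ℝ}

theorem ae_cost_nonneg (hγ : IsAdmissible Ω₂ ν h γ) (hΩ : IsOpen Ω₂) (hν : ∀ᵐ y ∂ν, y ∈ Λ)
    (hδ : 0 < δ) (hΛ : ∀ y ∈ Λ, y.2 ≤ -δ) : ∀ᵐ q ∂γ, 0 ≤ cost q.1 q.2 := by
  filter_upwards [hγ.ae_mem hΩ hν] with q hq
  exact cost_nonneg hq.1.2.1.le (by linarith [hΛ q.2 hq.2])

theorem integrable_cost (hγ : IsAdmissible Ω₂ ν h γ) (hΩ : IsOpen Ω₂) (hν : ∀ᵐ y ∂ν, y ∈ Λ)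
    (hδ : 0 < δ) (hΛ : ∀ y ∈ Λ, y.2 ≤ -δ) (hfin : energy γ ≠ ⊤) :
    Integrable (fun q : Space × Space => cost q.1 q.2) γ :=
  (lintegral_ofReal_ne_top_iff_integrable continuous_cost.aestronglyMeasurable
    (hγ.ae_cost_nonneg hΩ hν hδ hΛ)).1 hfin

theorem energy_eq (hγ : IsAdmissible Ω₂ ν h γ) (hΩ : IsOpen Ω₂) (hν : ∀ᵐ y ∂ν, y ∈ Λ)
    (hδ : 0 < δ) (hΛ : ∀ y ∈ Λ, y.2 ≤ -δ)
    (hi : Integrable (fun q : Space × Space => cost q.1 q.2) γ) :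
    energy γ = ENNReal.ofReal (∫ q, cost q.1 q.2 ∂γ) :=
  (ofReal_integral_eq_lintegral_ofReal hi (hγ.ae_cost_nonneg hΩ hν hδ hΛ)).symm

variable [CompactSpace Λ] [IsProbabilityMeasure ν]

/-- The gap is integrable over the region of an admissible pair of finite energy. It is bounded
below, and bounded above by the cost up to a bounded function of `y`. -/
theorem integrable_gap [Nonempty Λ] (hγ : IsAdmissible Ω₂ ν h γ) (hΩ : IsOpen Ω₂)
    (hΩb : Bornology.IsBounded Ω₂) (hν : ∀ᵐ y ∂ν, y ∈ Λ) (hδ : 0 < δ) (hΛ : ∀ y ∈ Λ, y.2 ≤ -δ)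
    (hi : Integrable (fun q : Space × Space => cost q.1 q.2) γ) (R : C(Λ, ℝ)) :
    Integrable (gap R) (sigma Ω₂ h) := by
  have := hγ.isProbabilityMeasure
  obtain ⟨r, hrc, hr⟩ := exists_continuous_extension R
  obtain ⟨m, hm0, hm⟩ := exists_neg_le_gap hΩb hδ hΛ R
  have hb : Integrable (fun q : Space × Space => ‖q.2.1‖ ^ 2 / 2 - r q.2) γ := by
    have := integrable_half_sq_sub hν hrc
    rw [← hγ.snd_marginal] at this
    exact this.comp_measurable measurable_snd
  have hg : Integrable (fun q : Space × Space => gap R q.1) γ := by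
    refine Integrable.mono' ((hi.abs.add hb.abs).add (integrable_const m))
      ((continuous_gap R).comp continuous_fst).aestronglyMeasurable ?_
    filter_upwards [hγ.ae_mem hΩ hν] with q hq
    have h1 := cost_eq_gap_add hr q.1 ⟨q.2, hq.2⟩
    have h2 := dot_sub_le_conj R q.1 ⟨q.2, hq.2⟩
    have h3 := hm q.1 hq.1.1 hq.1.2.1.le
    simp only [Pi.add_apply, Real.norm_eq_abs] at h1 h2 ⊢
    rw [abs_le]
    constructor
    · linarith [abs_nonneg (cost q.1 q.2), abs_nonneg (‖q.2.1‖ ^ 2 / 2 - r q.2)]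
    · linarith [le_abs_self (cost q.1 q.2), neg_abs_le (‖q.2.1‖ ^ 2 / 2 - r q.2)]
  rw [← hγ.fst_marginal]
  exact (integrable_map_measure (continuous_gap R).aestronglyMeasurable
    measurable_fst.aemeasurable).2 hg

/-- Weak duality: the primal energy exceeds the dual one by the integral of the slack. -/
theorem integral_cost_eq (hγ : IsAdmissible Ω₂ ν h γ)
    (hν : ∀ᵐ y ∂ν, y ∈ Λ)
    (hi : Integrable (fun q : Space × Space => cost q.1 q.2) γ) {R : C(Λ, ℝ)}
    (hgi : Integrable (gap R) (sigma Ω₂ h)) {r : Space → ℝ} (hrc : Continuous r) :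
    Integrable (fun q : Space × Space =>
        cost q.1 q.2 - gap R q.1 - (‖q.2.1‖ ^ 2 / 2 - r q.2)) γ ∧
      ∫ q, (cost q.1 q.2 - gap R q.1 - (‖q.2.1‖ ^ 2 / 2 - r q.2)) ∂γ =
        ∫ q, cost q.1 q.2 ∂γ -
          ((∫ x, gap R x ∂(sigma Ω₂ h)) + ∫ y, (‖y.1‖ ^ 2 / 2 - r y) ∂ν) := by
  have hb := integrable_half_sq_sub hν hrc
  rw [← hγ.snd_marginal] at hb ⊢
  rw [← hγ.fst_marginal] at hgi ⊢
  have hb' : Integrable (fun q : Space × Space => ‖q.2.1‖ ^ 2 / 2 - r q.2) γ :=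
    hb.comp_measurable measurable_snd
  have hg' : Integrable (fun q : Space × Space => gap R q.1) γ :=
    hgi.comp_measurable measurable_fst
  have hs : Integrable (fun q : Space × Space => cost q.1 q.2 - gap R q.1) γ := hi.sub hg'
  refine ⟨hs.sub hb', ?_⟩
  rw [integral_sub hs hb', integral_sub hi hg',
    integral_map measurable_fst.aemeasurable hgi.1, integral_map measurable_snd.aemeasurable hb.1]
  ring

theorem le_integral_cost [Nonempty Λ] (hγ : IsAdmissible Ω₂ ν h γ) (hΩ : IsOpen Ω₂)
    (hν : ∀ᵐ y ∂ν, y ∈ Λ)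
    (hi : Integrable (fun q : Space × Space => cost q.1 q.2) γ) {R : C(Λ, ℝ)}
    (hgi : Integrable (gap R) (sigma Ω₂ h)) {r : Space → ℝ} (hrc : Continuous r)
    (hr : ∀ y : Λ, r y = R y) :
    (∫ x, gap R x ∂(sigma Ω₂ h)) + ∫ y, (‖y.1‖ ^ 2 / 2 - r y) ∂ν ≤ ∫ q, cost q.1 q.2 ∂γ ∧
      (∫ q, cost q.1 q.2 ∂γ ≤
          (∫ x, gap R x ∂(sigma Ω₂ h)) + ∫ y, (‖y.1‖ ^ 2 / 2 - r y) ∂ν →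
        ∀ᵐ q ∂γ, ∃ y : Λ, (y : Space) = q.2 ∧ conj R q.1 = dot q.1 y - R y) := by
  obtain ⟨hsi, hs⟩ := hγ.integral_cost_eq hν hi hgi hrc
  have h0 : 0 ≤ᵐ[γ] fun q : Space × Space =>
      cost q.1 q.2 - gap R q.1 - (‖q.2.1‖ ^ 2 / 2 - r q.2) := by
    filter_upwards [hγ.ae_mem hΩ hν] with q hq
    have h1 := cost_eq_gap_add hr q.1 ⟨q.2, hq.2⟩
    have h2 := dot_sub_le_conj R q.1 ⟨q.2, hq.2⟩
    simp only [Pi.zero_apply] at h1 h2 ⊢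
    linarith
  have hnn : 0 ≤ ∫ q, (cost q.1 q.2 - gap R q.1 - (‖q.2.1‖ ^ 2 / 2 - r q.2)) ∂γ :=
    integral_nonneg_of_ae h0
  refine ⟨by linarith, fun hle => ?_⟩
  have hz := (integral_eq_zero_iff_of_nonneg_ae h0 hsi).1 (le_antisymm (by linarith) hnn)
  filter_upwards [hγ.ae_mem hΩ hν, hz] with q hq hqz
  refine ⟨⟨q.2, hq.2⟩, rfl, ?_⟩
  have h1 := cost_eq_gap_add hr q.1 ⟨q.2, hq.2⟩
  simp only [Pi.zero_apply] at h1 hqz ⊢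
  linarith

end IsAdmissible

section

variable [CompactSpace Λ] [Nonempty Λ] {Ω₂ : Set Plane} {ν : Measure Space}
  [IsProbabilityMeasure ν] {δ H : ℝ}

/-- A measure on `ℝ³ × ℝ³` carried by the graph of `T` is determined by its first marginal. -/
theorem eq_map_of_ae_eq {γ : Measure (Space × Space)} {T : Space → Space} (hT : Measurable T)
    (h : ∀ᵐ q ∂γ, q.2 = T q.1) : γ = (γ.map Prod.fst).map fun x => (x, T x) := by
  have hm : Measurable fun x => (x, T x) := measurable_id.prodMk hT
  rw [Measure.map_map hm measurable_fst]
  conv_lhs => rw [← Measure.map_id (μ := γ)]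
  refine Measure.map_congr ?_
  filter_upwards [h] with q hq
  exact Prod.ext rfl hq

/-- A maximizer of the dual problem yields the minimizer of the energy, and the only one. -/
theorem isMinimizer_plan (hΩ : IsOpen Ω₂) (hΩne : Ω₂.Nonempty) (hΩb : Bornology.IsBounded Ω₂)
    (hδ : 0 < δ) (hH0 : 0 ≤ H) (hH : heightBound Ω₂ Λ δ < H) (hΛ : ∀ y ∈ Λ, y.2 ≤ -δ)
    (hν : ∀ᵐ y ∂ν, y ∈ Λ) {R : C(Λ, ℝ)}
    (hmap : (sigma Ω₂ (profile H R)).map (gradConj R) = ν) :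
    (∀ z ∈ Ω₂, profile H R z < H) ∧ IsMinimizer Ω₂ ν (profile H R) (plan Ω₂ H R) ∧
      ∀ h' γ', IsMinimizer Ω₂ ν h' γ' → EqOn h' (profile H R) Ω₂ ∧ γ' = plan Ω₂ H R := by
  have hpc : Continuous (profile H R) := continuous_profile hδ hH0 hΛ R
  have hp0 : ∀ z ∈ Ω₂, 0 ≤ profile H R z := fun z _ => (profile_mem hH0 R z).1
  have hpi : IntegrableOn (profile H R) Ω₂ := by
    obtain ⟨r, hr⟩ := hΩb.subset_closedBall 0
    exact (hpc.continuousOn.integrableOn_compact (isCompact_closedBall 0 r)).mono_set hr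
  have hvol : volume (subgraph Ω₂ (profile H R)) = 1 := by
    have h1 := congrArg (fun μ : Measure Space => μ univ) hmap
    simpa [Measure.map_apply (measurable_gradConj R) MeasurableSet.univ, sigma] using h1
  -- The mass of `σ_h` is that of its image `ν`, which fixes the integral of the profile.
  have hone := integral_eq_one_of_volume_subgraph hΩ.measurableSet hp0 hpi hvol
  have hlt : ∀ z ∈ Ω₂, profile H R z < H := fun z hz =>
    profile_lt hΩ hΩne hΩb hδ hH0 hH hΛ R hone hpi hz
  have hadm : IsAdmissible Ω₂ ν (profile H R) (plan Ω₂ H R) :=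
    ⟨hp0, hpc.continuousOn, hone, map_fst_plan Ω₂ H R, (map_snd_plan Ω₂ H R).trans hmap⟩
  obtain ⟨r, hrc, hr⟩ := exists_continuous_extension R
  have hgi := integrable_gap_profile (Ω₂ := Ω₂) hΩb hH0 R
  set v := (∫ x, gap R x ∂(sigma Ω₂ (profile H R))) + ∫ y, (‖y.1‖ ^ 2 / 2 - r y) ∂ν with hv
  have hgrad : ∀ᵐ x ∂(sigma Ω₂ (profile H R)),
      cost x (gradConj R x) = gap R x + (‖(gradConj R x).1‖ ^ 2 / 2 - r (gradConj R x)) := by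
    filter_upwards [ae_restrict_of_ae (ae_eq_gradConj R)] with x hx
    obtain ⟨y, hy⟩ := exists_conj_eq R x
    rw [← hx y hy, cost_eq_gap_add hr]
    linarith
  have hbT : Integrable (fun x => ‖(gradConj R x).1‖ ^ 2 / 2 - r (gradConj R x))
      (sigma Ω₂ (profile H R)) := by
    have := integrable_half_sq_sub hν hrc
    rw [← hmap] at this
    exact this.comp_measurable (measurable_gradConj R)
  have hcT : Integrable (fun x => cost x (gradConj R x)) (sigma Ω₂ (profile H R)) :=
    (hgi.add hbT).congr (hgrad.mono fun x hx => hx.symm)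
  have hci : Integrable (fun q : Space × Space => cost q.1 q.2) (plan Ω₂ H R) :=
    (integrable_map_measure continuous_cost.aestronglyMeasurable
      (measurable_graph_gradConj R).aemeasurable).2 hcT
  have hval : ∫ q, cost q.1 q.2 ∂(plan Ω₂ H R) = v := by
    rw [plan, integral_map (measurable_graph_gradConj R).aemeasurable
      continuous_cost.aestronglyMeasurable]
    rw [integral_congr_ae hgrad, integral_add hgi hbT, hv]
    congr 1
    have hc : Continuous fun y : Space => ‖y.1‖ ^ 2 / 2 - r y := by fun_prop
    conv_rhs => rw [← hmap]
    exact (integral_map (measurable_gradConj R).aemeasurable hc.aestronglyMeasurable).symm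
  have hv0 : 0 ≤ v := hval ▸ integral_nonneg_of_ae (hadm.ae_cost_nonneg hΩ hν hδ hΛ)
  have henergy : energy (plan Ω₂ H R) = ENNReal.ofReal v := by
    rw [hadm.energy_eq hΩ hν hδ hΛ hci, hval]
  refine ⟨hlt, ⟨hadm, fun h' γ' hγ' => ?_⟩, fun h' γ' hγ' => ?_⟩
  · rcases eq_or_ne (energy γ') ⊤ with htop | hfin
    · rw [htop]
      exact le_top
    have hi' := hγ'.integrable_cost hΩ hν hδ hΛ hfin
    have hgi' := hγ'.integrable_gap hΩ hΩb hν hδ hΛ hi' R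
    have h1 := (hγ'.le_integral_cost hΩ hν hi' hgi' hrc hr).1
    have h2 := (integral_gap_profile_le hΩ hΩb hδ hH0 hΛ R hlt hγ'.nonneg hγ'.continuousOn hgi').1
    rw [henergy, hγ'.energy_eq hΩ hν hδ hΛ hi']
    exact ENNReal.ofReal_le_ofReal (by linarith)
  · obtain ⟨hγ', hmin⟩ := hγ'
    have hle := hmin _ _ hadm
    rw [henergy] at hle
    have hi' := hγ'.integrable_cost hΩ hν hδ hΛ (hle.trans_lt ENNReal.ofReal_lt_top).ne
    have hgi' := hγ'.integrable_gap hΩ hΩb hν hδ hΛ hi' R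
    rw [hγ'.energy_eq hΩ hν hδ hΛ hi', ENNReal.ofReal_le_ofReal_iff hv0] at hle
    have h1 := hγ'.le_integral_cost hΩ hν hi' hgi' hrc hr
    have h2 := integral_gap_profile_le hΩ hΩb hδ hH0 hΛ R hlt hγ'.nonneg hγ'.continuousOn hgi'
    have heq : EqOn h' (profile H R) Ω₂ := h2.2 (by linarith [h1.1])
    refine ⟨heq, ?_⟩
    have htight := h1.2 (by linarith [h2.1])
    have huniq : ∀ᵐ x ∂(γ'.map Prod.fst), ∀ y : Λ, conj R x = dot x y - R y →
        (y : Space) = gradConj R x := by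
      rw [hγ'.fst_marginal]
      exact ae_restrict_of_ae (ae_eq_gradConj R)
    have hgraph : ∀ᵐ q ∂γ', q.2 = gradConj R q.1 := by
      filter_upwards [htight, ae_of_ae_map measurable_fst.aemeasurable huniq] with q hq hqu
      obtain ⟨y, hy, hqy⟩ := hq
      rw [← hy]
      exact hqu y hqy
    rw [eq_map_of_ae_eq (measurable_gradConj R) hgraph, hγ'.fst_marginal, plan, sigma, sigma,
      subgraph_congr heq]

end

/-! ### Convex conjugate maximizers of the dual functional -/

/-- If the slopes `p` satisfy this inequality, then `f` is constant: sum it over a fine partition of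
the interval. It holds if `f` is the difference of two convex functions that have the common
subgradient `p t` at every point `t`. -/
theorem eq_of_abs_sub_le_mul_sub {f p : ℝ → ℝ} {a b : ℝ} (hab : a ≤ b)
    (h : ∀ s ∈ Icc a b, ∀ t ∈ Icc a b, |f s - f t| ≤ (s - t) * (p s - p t)) : f a = f b := by
  have key : ∀ n : ℕ, |f b - f a| ≤ (b - a) * (p b - p a) * (1 / ((n : ℝ) + 1)) := by
    intro n
    have hn : (0 : ℝ) < n + 1 := by positivity
    set d := (b - a) / ((n : ℝ) + 1) with hd
    have hd0 : 0 ≤ d := div_nonneg (sub_nonneg.2 hab) hn.le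
    have hdn : ((n : ℝ) + 1) * d = b - a := by rw [hd]; field_simp
    have hmem : ∀ k : ℕ, k ≤ n + 1 → a + k * d ∈ Icc a b := by
      intro k hk
      have hk' : (k : ℝ) ≤ n + 1 := by exact_mod_cast hk
      refine ⟨by nlinarith [mul_nonneg (Nat.cast_nonneg (α := ℝ) k) hd0], ?_⟩
      nlinarith [mul_le_mul_of_nonneg_right hk' hd0]
    have hind : ∀ k : ℕ, k ≤ n + 1 → |f (a + k * d) - f a| ≤ d * (p (a + k * d) - p a) := by
      intro k
      induction k with
      | zero => intro _; simp
      | succ k ih =>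
        intro hk
        have h1 := ih (by omega)
        have h2 := h _ (hmem (k + 1) hk) _ (hmem k (by omega))
        have h3 : (a + ((k + 1 : ℕ) : ℝ) * d) - (a + k * d) = d := by push_cast; ring
        rw [h3] at h2
        have h4 := abs_sub_le (f (a + ((k + 1 : ℕ) : ℝ) * d)) (f (a + k * d)) (f a)
        linarith
    have := hind (n + 1) le_rfl
    push_cast at this
    rw [hdn, add_sub_cancel] at this
    refine this.trans_eq ?_
    rw [hd]
    ring
  have hlim := (tendsto_one_div_add_atTop_nhds_zero_nat (𝕜 := ℝ)).const_mul
    ((b - a) * (p b - p a))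
  rw [mul_zero] at hlim
  have := ge_of_tendsto' hlim key
  exact (sub_eq_zero.1 (abs_nonpos_iff.1 this)).symm

section

variable [CompactSpace Λ] [Nonempty Λ] {Ω₂ : Set Plane} {δ H : ℝ}

theorem isTruncatedProfile_profile (hδ : 0 < δ) (hH : 0 ≤ H) (hΛ : ∀ y ∈ Λ, y.2 ≤ -δ)
    (R : C(Λ, ℝ)) {P : Space → ℝ} (hP : EqOn P (conj R) (cylinder Ω₂ H)) :
    IsTruncatedProfile Ω₂ H P (profile H R) := by
  intro z hz
  have hm := profile_mem hH R z
  refine ⟨hm, fun s hs hne => ?_⟩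
  have hpot : ∀ s ∈ Icc 0 H, potential P z s = ∫ t in (0 : ℝ)..s, gap R (z, t) := by
    intro s hs
    refine intervalIntegral.integral_congr fun t ht => ?_
    rw [uIcc_of_le hs.1] at ht
    simp only [gap, hP (show (z, t) ∈ cylinder Ω₂ H from ⟨hz, ht.1, ht.2.trans hs.2⟩)]
  have hc : Continuous fun t : ℝ => gap R (z, t) := (continuous_gap R).comp (by fun_prop)
  have hii : ∀ a b : ℝ, IntervalIntegrable (fun t => gap R (z, t)) volume a b := fun a b =>
    hc.intervalIntegrable a b
  rw [hpot s hs, hpot _ hm]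
  rcases lt_or_gt_of_ne hne with hlt | hgt
  · have h1 := intervalIntegral.integral_add_adjacent_intervals (hii 0 s) (hii s (profile H R z))
    have h2 : 0 < ∫ t in s..profile H R z, -gap R (z, t) := by
      refine intervalIntegral.intervalIntegral_pos_of_pos_on (hii _ _).neg (fun t ht => ?_) hlt
      have := gap_le_of_lt_profile hΛ R (hs.1.trans ht.1.le) ht.2
      have h3 := mul_pos hδ (sub_pos.2 ht.2)
      linarith
    rw [intervalIntegral.integral_neg] at h2
    linarith
  · have h1 := intervalIntegral.integral_add_adjacent_intervals (hii 0 (profile H R z))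
      (hii (profile H R z) s)
    have h2 : 0 < ∫ t in profile H R z..s, gap R (z, t) := by
      refine intervalIntegral.intervalIntegral_pos_of_pos_on (hii _ _) (fun t ht => ?_) hgt
      have := le_gap_of_profile_le hH hΛ R ht.1.le (hgt.trans_le hs.2)
      have h3 := mul_pos hδ (sub_pos.2 ht.1)
      linarith
    linarith

theorem gap_profile_eq_zero (hΛ : ∀ y ∈ Λ, y.2 ≤ -δ) (hH : 0 ≤ H)
    (R : C(Λ, ℝ)) {z : Plane} (h0 : 0 < profile H R z) (hlt : profile H R z < H) :
    gap R (z, profile H R z) = 0 := by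
  refine le_antisymm ?_ (by simpa using le_gap_of_profile_le hH hΛ R le_rfl hlt)
  have hc : Continuous fun t : ℝ => gap R (z, t) + δ * (profile H R z - t) :=
    ((continuous_gap R).comp (by fun_prop : Continuous fun t : ℝ => (z, t))).add (by fun_prop)
  have := le_of_tendsto (hc.continuousWithinAt (s := Iio (profile H R z)) (x := profile H R z))
    (b := 0) (by
      filter_upwards [Ioo_mem_nhdsLT h0] with t ht
      linarith [gap_le_of_lt_profile hΛ R ht.1.le ht.2])
  simpa using this

/-- The transform of the mean is at most the mean of the transforms; equality means that both
suprema are attained at a common point. -/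
theorem conj_mean_le (R₀ R₁ : C(Λ, ℝ)) (x : Space) :
    conj ((1 / 2 : ℝ) • (R₀ + R₁)) x ≤ (conj R₀ x + conj R₁ x) / 2 ∧
      (conj ((1 / 2 : ℝ) • (R₀ + R₁)) x = (conj R₀ x + conj R₁ x) / 2 ↔
        ∃ y : Λ, conj R₀ x = dot x y - R₀ y ∧ conj R₁ x = dot x y - R₁ y) := by
  obtain ⟨y, hy⟩ := exists_conj_eq ((1 / 2 : ℝ) • (R₀ + R₁)) x
  have e : ∀ y : Λ, ((1 / 2 : ℝ) • (R₀ + R₁)) y = (R₀ y + R₁ y) / 2 := fun y => by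
    simp only [ContinuousMap.smul_apply, ContinuousMap.add_apply, smul_eq_mul]
    ring
  rw [e] at hy
  have h0 := dot_sub_le_conj R₀ x y
  have h1 := dot_sub_le_conj R₁ x y
  have hle : conj ((1 / 2 : ℝ) • (R₀ + R₁)) x ≤ (conj R₀ x + conj R₁ x) / 2 := by linarith
  refine ⟨hle, fun heq => ⟨y, by linarith, by linarith⟩, ?_⟩
  rintro ⟨y', h0', h1'⟩
  have := dot_sub_le_conj ((1 / 2 : ℝ) • (R₀ + R₁)) x y'
  rw [e] at this
  linarith

/-- Two potentials with the same profile below the lid and almost everywhere the same gradient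
below it agree there: they have common subgradients, so that they differ by a constant on each
column, and they agree on the free surface. -/
theorem conj_eqOn_subgraph (hΩ : IsOpen Ω₂) (hδ : 0 < δ) (hH : 0 ≤ H)
    (hΛ : ∀ y ∈ Λ, y.2 ≤ -δ) {R₀ R₁ : C(Λ, ℝ)} (hlt : ∀ z ∈ Ω₂, profile H R₀ z < H)
    (hprof : EqOn (profile H R₀) (profile H R₁) Ω₂)
    (hgrad : ∀ᵐ x ∂(sigma Ω₂ (profile H R₀)), gradConj R₀ x = gradConj R₁ x) :
    EqOn (conj R₀) (conj R₁) (subgraph Ω₂ (profile H R₀)) := by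
  have hS := isOpen_subgraph hΩ (continuous_profile (H := H) hδ hH hΛ R₀).continuousOn
  have hc₀ := continuous_conj R₀
  have hc₁ := continuous_conj R₁
  have hmean : EqOn (conj ((1 / 2 : ℝ) • (R₀ + R₁))) (fun x => (conj R₀ x + conj R₁ x) / 2)
      (subgraph Ω₂ (profile H R₀)) := by
    refine Measure.eqOn_open_of_ae_eq (μ := volume) ?_ hS (continuous_conj _).continuousOn
      (Continuous.continuousOn (by fun_prop))
    filter_upwards [hgrad, ae_restrict_of_ae (ae_eq_gradConj R₀),
      ae_restrict_of_ae (ae_eq_gradConj R₁)] with x hx h0 h1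
    obtain ⟨y, hy⟩ := exists_conj_eq R₀ x
    obtain ⟨y', hy'⟩ := exists_conj_eq R₁ x
    have : y' = y := Subtype.ext ((h1 y' hy').trans (hx.symm.trans (h0 y hy).symm))
    exact (conj_mean_le R₀ R₁ x).2.2 ⟨y, hy, this ▸ hy'⟩
  rintro ⟨z, s⟩ hx
  obtain ⟨hz, hs0, hs⟩ := hx
  simp only at hz hs0 hs
  -- The difference `D` is constant along the column and vanishes at its top.
  let D : ℝ → ℝ := fun t => conj R₀ (z, t) - conj R₁ (z, t)
  have hD : Continuous D := (hc₀.comp (by fun_prop)).sub (hc₁.comp (by fun_prop))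
  -- `q t` is the vertical component of a subgradient that both potentials have at `(z, t)`; its
  -- value outside the interval plays no role.
  have hcommon : ∀ t : ℝ, ∃ q : ℝ, t ∈ Ico s (profile H R₀ z) → ∀ t' : ℝ,
      conj R₀ (z, t) - conj R₀ (z, t') ≤ (t - t') * q ∧
        conj R₁ (z, t) - conj R₁ (z, t') ≤ (t - t') * q := by
    intro t
    by_cases ht : t ∈ Ico s (profile H R₀ z)
    · obtain ⟨y, h0, h1⟩ := (conj_mean_le R₀ R₁ (z, t)).2.1
        (hmean ⟨hz, hs0.trans_le ht.1, ht.2⟩)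
      refine ⟨(y : Space).2, fun _ t' => ?_⟩
      have h2 := conj_sub_conj_le h0 (z, t')
      have h3 := conj_sub_conj_le h1 (z, t')
      simp only [dot, Prod.mk_sub_mk, sub_self, inner_zero_left, zero_add] at h2 h3
      exact ⟨h2, h3⟩
    · exact ⟨0, fun h => (ht h).elim⟩
  choose q hq using hcommon
  have hconst : ∀ t ∈ Ioo s (profile H R₀ z), D t = D s := by
    intro t ht
    refine (eq_of_abs_sub_le_mul_sub (p := q) ht.1.le fun a ha b hb => ?_).symm
    have h1 := hq a ⟨ha.1, ha.2.trans_lt ht.2⟩ b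
    have h2 := hq b ⟨hb.1, hb.2.trans_lt ht.2⟩ a
    simp only [D]
    rw [abs_le]
    constructor <;> nlinarith [h1.1, h1.2, h2.1, h2.2]
  have hpos : 0 < profile H R₀ z := hs0.trans hs
  have htop : D (profile H R₀ z) = D s := by
    have h1 : Tendsto D (𝓝[<] (profile H R₀ z)) (𝓝 (D (profile H R₀ z))) :=
      hD.continuousWithinAt
    refine tendsto_nhds_unique h1 (tendsto_const_nhds.congr' ?_)
    filter_upwards [Ioo_mem_nhdsLT hs] with t ht using (hconst t ht).symm
  have g0 := gap_profile_eq_zero hΛ hH R₀ hpos (hlt z hz)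
  have hz' := hprof hz
  have g1 := gap_profile_eq_zero hΛ hH R₁ (hz' ▸ hpos) (hz' ▸ hlt z hz)
  rw [← hz'] at g1
  simp only [gap] at g0 g1
  have : D s = 0 := by
    rw [← htop]
    simp only [D]
    linarith
  exact sub_eq_zero.1 this

end

section

variable {Ω₂ : Set Plane} {ν : Measure Space} [IsProbabilityMeasure ν] {δ H : ℝ}

theorem isProbabilityMeasure_comap_subtype (hΛm : MeasurableSet Λ) (hν : ∀ᵐ y ∂ν, y ∈ Λ) :
    IsProbabilityMeasure (ν.comap (Subtype.val : Λ → Space)) := by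
  refine ⟨?_⟩
  rw [comap_subtype_coe_apply hΛm, image_univ, Subtype.range_coe]
  exact (prob_compl_eq_zero_iff hΛm).1 hν

variable [CompactSpace Λ] [Nonempty Λ]

/-- A convex conjugate maximizer of `J_ν^H` comes from a continuous maximizer of the dual value. -/
theorem exists_dualValue_maximizer_of_isDualMaximizer (hΩ : MeasurableSet Ω₂)
    (hΩne : Ω₂.Nonempty) (hΩb : Bornology.IsBounded Ω₂) (hδ : 0 < δ) (hH : 0 ≤ H)
    (hΛ : ∀ y ∈ Λ, y.2 ≤ -δ) {P R : Space → ℝ}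
    (hmax : IsDualMaximizer Ω₂ Λ ν H P R) (hconj : IsConvexConjugate (cylinder Ω₂ H) Λ P R) :
    ∃ R' : C(Λ, ℝ), EqOn P (conj R') (cylinder Ω₂ H) ∧
      ∀ R'' : C(Λ, ℝ), dualValue Ω₂ ν H R'' ≤ dualValue Ω₂ ν H R' := by
  have hΛm : MeasurableSet Λ := (isCompact_iff_compactSpace.2 ‹CompactSpace Λ›).measurableSet
  obtain ⟨B, hB⟩ := hΩb.exists_norm_le
  have hBH : 0 ≤ B + H := add_nonneg ((norm_nonneg _).trans (hB _ hΩne.some_mem)) hH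
  have hlip := abs_sub_le_of_isLUB_dot_sub (B := B) (H := H) (fun x hx => hB _ hx.1)
    (fun x hx => abs_le.2 ⟨by linarith [hx.2.1], hx.2.2⟩) hconj.2
  let R' : C(Λ, ℝ) := ⟨fun y => R y, continuous_of_abs_sub_le hBH hlip⟩
  have hP : EqOn P (conj R') (cylinder Ω₂ H) := by
    intro x hx
    refine (hconj.1 x hx).unique ?_
    rw [image_eq_range]
    exact isLUB_conj R' x
  refine ⟨R', hP, fun R'' => ?_⟩
  rw [← dualFunctional_eq_dualValue hΩ hΩb hδ hH hΛm hΛ ν R' hP (fun _ => rfl)]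
  obtain ⟨r, hrc, hr⟩ := exists_continuous_extension R''
  rw [← dualFunctional_eq_dualValue hΩ hΩb hδ hH hΛm hΛ ν R'' (fun _ _ => rfl) hr]
  refine hmax.2 _ _ ⟨integrableOn_cylinder hΩb H (continuous_conj R''), ?_, ?_⟩
  · exact hrc.continuousOn.integrableOn_compact (isCompact_iff_compactSpace.2 ‹_›)
  · intro x _ y hy
    have := dot_sub_le_conj R'' x ⟨y, hy⟩
    rw [← hr] at this
    linarith

end

end SemiGeostrophic

open SemiGeostrophic in
theorem corollary2p19
    (Ω₂ : Set SemiGeostrophic.Plane)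
    (hΩ_open : IsOpen Ω₂) (hΩ_convex : Convex ℝ Ω₂) (hΩ_nonempty : Ω₂.Nonempty)
    (hΩ_bounded : Bornology.IsBounded Ω₂)
    (δ : ℝ) (hδ : 0 < δ)
    (Λ : Set SemiGeostrophic.Space) (hΛ_compact : IsCompact Λ)
    (hΛ : ∀ y ∈ Λ, y.2 ∈ Set.Icc (-(1 / δ)) (-δ))
    (ν : MeasureTheory.Measure SemiGeostrophic.Space) [MeasureTheory.IsProbabilityMeasure ν]
    (hν : ν.support ⊆ Λ)
    (H : ℝ) (hH : SemiGeostrophic.heightBound Ω₂ Λ δ < H) :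
    (∃ (h : SemiGeostrophic.Plane → ℝ)
        (γ : MeasureTheory.Measure (SemiGeostrophic.Space × SemiGeostrophic.Space)),
      SemiGeostrophic.IsMinimizer Ω₂ ν h γ ∧
      ∀ (h' : SemiGeostrophic.Plane → ℝ)
        (γ' : MeasureTheory.Measure (SemiGeostrophic.Space × SemiGeostrophic.Space)),
        SemiGeostrophic.IsMinimizer Ω₂ ν h' γ' → Set.EqOn h' h Ω₂ ∧ γ' = γ) ∧
    (∀ P₀ R₀ P₁ R₁ : SemiGeostrophic.Space → ℝ,
      SemiGeostrophic.IsDualMaximizer Ω₂ Λ ν H P₀ R₀ →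
      SemiGeostrophic.IsConvexConjugate (SemiGeostrophic.cylinder Ω₂ H) Λ P₀ R₀ →
      SemiGeostrophic.IsDualMaximizer Ω₂ Λ ν H P₁ R₁ →
      SemiGeostrophic.IsConvexConjugate (SemiGeostrophic.cylinder Ω₂ H) Λ P₁ R₁ →
      ∃ h : SemiGeostrophic.Plane → ℝ,
        SemiGeostrophic.IsTruncatedProfile Ω₂ H P₀ h ∧
        SemiGeostrophic.IsTruncatedProfile Ω₂ H P₁ h ∧
        Set.EqOn P₀ P₁ (SemiGeostrophic.subgraph Ω₂ h)) := by
  have hνΛ : ∀ᵐ y ∂ν, y ∈ Λ := Filter.mem_of_superset Measure.support_mem_ae hν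
  have : CompactSpace Λ := isCompact_iff_compactSpace.1 hΛ_compact
  have : Nonempty Λ := Set.Nonempty.to_subtype hνΛ.exists
  have := isProbabilityMeasure_comap_subtype hΛ_compact.measurableSet hνΛ
  have hΛδ : ∀ y ∈ Λ, y.2 ≤ -δ := fun y hy => (hΛ y hy).2
  have hΩm := hΩ_open.measurableSet
  have hV : 0 < volume.real Ω₂ := ENNReal.toReal_pos
    (hΩ_open.measure_pos volume hΩ_nonempty).ne' hΩ_bounded.measure_lt_top.ne
  have hVH : 2 / volume.real Ω₂ < H := (two_div_le_heightBound hδ).trans_lt hH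
  have hH0 : 0 ≤ H := (by positivity : 0 ≤ 2 / volume.real Ω₂).trans hVH.le
  have hvol : 1 < volume.real (cylinder Ω₂ H) := by
    have : volume.real (cylinder Ω₂ H) = volume.real Ω₂ * H := by
      have := measureReal_prod_prod (μ := (volume : Measure Plane)) (ν := (volume : Measure ℝ))
        Ω₂ (Icc 0 H)
      rw [Real.volume_real_Icc_of_le hH0, sub_zero] at this
      exact this
    rw [div_lt_iff₀' hV] at hVH
    linarith
  have hmin : ∀ {R : C(Λ, ℝ)}, (∀ R' : C(Λ, ℝ), dualValue Ω₂ ν H R' ≤ dualValue Ω₂ ν H R) → _ :=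
    fun {R} hmax => isMinimizer_plan hΩ_open hΩ_nonempty hΩ_bounded hδ hH0 hH hΛδ hνΛ
      (map_gradConj_eq hΛ_compact.measurableSet hνΛ hΩm hΩ_bounded hδ hH0 hΛδ hmax)
  constructor
  · obtain ⟨R, hmax⟩ := exists_dualValue_maximizer (Λ := Λ) (ν := ν) hΩm hΩ_nonempty hΩ_bounded
      hH0 hvol
    exact ⟨_, _, (hmin hmax).2⟩
  · intro P₀ R₀ P₁ R₁ hm₀ hc₀ hm₁ hc₁
    obtain ⟨S₀, hP₀, hmax₀⟩ := exists_dualValue_maximizer_of_isDualMaximizer hΩm hΩ_nonempty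
      hΩ_bounded hδ hH0 hΛδ hm₀ hc₀
    obtain ⟨S₁, hP₁, hmax₁⟩ := exists_dualValue_maximizer_of_isDualMaximizer hΩm hΩ_nonempty
      hΩ_bounded hδ hH0 hΛδ hm₁ hc₁
    obtain ⟨hlt₀, hmin₀, -⟩ := hmin hmax₀
    obtain ⟨-, -, huniq₁⟩ := hmin hmax₁
    obtain ⟨hprof, hplan⟩ := huniq₁ _ _ hmin₀
    have hgrad : ∀ᵐ x ∂(sigma Ω₂ (profile H S₀)), gradConj S₀ x = gradConj S₁ x := by
      have hmeas : MeasurableSet {q : Space × Space | q.2 = gradConj S₁ q.1} :=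
        measurableSet_eq_fun measurable_snd ((measurable_gradConj S₁).comp measurable_fst)
      have h1 : ∀ᵐ q ∂(plan Ω₂ H S₁), q.2 = gradConj S₁ q.1 :=
        (ae_map_iff (measurable_graph_gradConj S₁).aemeasurable hmeas).2
          (Filter.Eventually.of_forall fun _ => rfl)
      rw [← hplan] at h1
      exact ae_of_ae_map (measurable_graph_gradConj S₀).aemeasurable h1
    have hsub : subgraph Ω₂ (profile H S₀) ⊆ cylinder Ω₂ H :=
      subgraph_subset_cylinder fun z _ => (profile_mem hH0 S₀ z).2
    refine ⟨profile H S₀, isTruncatedProfile_profile hδ hH0 hΛδ S₀ hP₀, ?_, ?_⟩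
    · intro z hz
      rw [hprof hz]
      exact isTruncatedProfile_profile hδ hH0 hΛδ S₁ hP₁ z hz
    · intro x hx
      rw [hP₀ (hsub hx), hP₁ (hsub hx)]
      exact conj_eqOn_subgraph hΩ_open hδ hH0 hΛδ hlt₀ hprof hgrad hx
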